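/- Let $\mathbb{R}_+=(0,\infty)$ and let $G=\mathbb{R}\times\mathbb{R}_+=\{(u,v)\}$ carry the measure $d\nu=v^{-2}\,du\,dv$. Write $\hat g(\xi)=\int_{\mathbb{R}} g(x)e^{-2\pi i x\xi}\,dx$ for the unitary Fourier transform on $L_2(\mathbb{R})$, and $H_2^+(\mathbb{R})=\{f\in L_2(\mathbb{R}):\hat f=0 \text{ a.e. on }(-\infty,0)\}$. For an integer $k\ge 0$ let $\ell_k(y)=e^{-y/2}L_k(y)$, where $L_k(y)=\sum_{i=0}^{k}(-1)^i\binom{k}{i}\frac{y^i}{i!}$ is the Laguerre polynomial, let $\psi^{(k)}\in L_2(\mathbb{R})$ be the wavelet with $\hat\psi^{(k)}(\xi)=\chi_{\mathbb{R}_+}(\xi)\sqrt{2\xi}\,\ell_k(2\xi)$, and put $\psi^{(k)}_v(x)=v^{-1/2}\psi^{(k)}(x/v)$. The wavelet subspace $$A^{(k)}=\{(u,v)\mapsto (f*\psi_v^{(k)})(u) : f\in H_2^+(\mathbb{R})\}\subset L_2(G,d\nu)$$ is closed; let $P^{(k)}$ be the orthogonal projection of $L_2(G,d\nu)$ onto it.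 For an essentially bounded measurable symbol $c$ on $G$ the Calderón–Toeplitz operator is $T_c^{(k)}:A^{(k)}\to A^{(k)}$, $T_c^{(k)}F=P^{(k)}(cF)$. **Theorem.** Let $c(u,v)=a(v)b(u)$ be a measurable, essentially bounded symbol on $G$, with $a:\mathbb{R}_+\to\mathbb{C}$, $b:\mathbb{R}\to\mathbb{C}$. Then for a.e. $u$ and all $\xi,t>0$ the function $v\mapsto b(u)a(v)\ell_k(2v\xi)\ell_k(2vt)$ is integrable on $\mathbb{R}_+$, and $T_c^{(k)}$ is unitarily equivalent to the bounded pseudo-differential operator $\mathfrak{C}^{(k)}_{\mathfrak c}$ on $L_2(\mathbb{R}_+)$ given by the iterated integral $$\left(\mathfrak{C}^{(k)}_{\mathfrak c}f\right)(\xi)=\int_{\mathbb{R}}du\int_{\mathbb{R}_+}\mathfrak{c}_k(\xi,t,u)\,f(t)\,e^{-2\pi i(\xi-t)u}\,dt,\qquad \xi\in\mathbb{R}_+,$$ with compound symbol $$\mathfrak{c}_k(\xi,t,u)=2\sqrt{t\xi}\;b(u)\int_{\mathbb{R}_+}a(v)\,\ell_k(2v\xi)\,\ell_k(2vt)\,dv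 .$$ Here the iterated integral has the following meaning. For $f\in C_c^\infty(\mathbb{R}_+)$ the formula holds for a.e. $\xi$, with absolutely convergent inner (for a.e. $u$) and outer Lebesgue integrals. For arbitrary $f\in L_2(\mathbb{R}_+)$ the integral is improper: for all real $r,s$ and a.e. $\xi$ the integrals over $t\in(0,M]$ and over $u\in[r,s]$ in $\int_{[r,s]}du\int_0^M\mathfrak{c}_k(\xi,t,u)f(t)e^{-2\pi i(\xi-t)u}\,dt$ converge absolutely (the inner ones for a.e. $u$), this expression has a finite limit $g_{r,s}(\xi)$ as $M\to\infty$, $g_{r,s}\in L_2(\mathbb{R}_+)$, and $g_{r,s}\to\mathfrak{C}^{(k)}_{\mathfrak c}f$ in $L_2(\mathbb{R}_+)$ as $r\to-\infty$, $s\to+\infty$. -/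

import Mathlib

open MeasureTheory Set Filter Topology
open scoped ENNReal FourierTransform Convolution ContDiff

noncomputable section

namespace CalderonToeplitz

/-- The Laguerre polynomial `L_k` of degree `k` and type `0`, as a function on `ℝ`. -/
def laguerre (k : ℕ) (y : ℝ) : ℝ :=
  ∑ i ∈ Finset.range (k + 1), (-1) ^ i * (k.choose i : ℝ) * y ^ i / (i.factorial : ℝ)

/-- The Laguerre function `ℓ_k(y) = e^{-y/2} L_k(y)`. -/
def laguerreFun (k : ℕ) (y : ℝ) : ℝ := Real.exp (-y / 2) * laguerre k y

/-- The left Haar measure `dν = v⁻² du dv` of the affine group; `G = {(u, v) : u ∈ ℝ, v > 0}` is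
realised inside `ℝ × ℝ`, and the complement of `G` is a null set. -/
def haarG : Measure (ℝ × ℝ) :=
  (volume : Measure ℝ).prod
    (((volume : Measure ℝ).restrict (Ioi 0)).withDensity fun v => ENNReal.ofReal (v ^ 2)⁻¹)

/-- `L₂(G, dν)`. -/
abbrev L2G : Type := Lp ℂ 2 haarG

/-- `L₂(ℝ₊)`. -/
abbrev L2Pos : Type := Lp ℂ 2 ((volume : Measure ℝ).restrict (Ioi 0))

/-- The function `χ₊(ξ) √(2ξ) ℓ_k(2ξ)`, the Fourier transform of the wavelet `ψ^{(k)}`. -/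
def waveletHat (k : ℕ) : ℝ → ℂ :=
  (Ioi (0 : ℝ)).indicator fun ξ => ((Real.sqrt (2 * ξ) * laguerreFun k (2 * ξ) : ℝ) : ℂ)

theorem continuous_laguerre (k : ℕ) : Continuous (laguerre k) := by
  unfold laguerre; fun_prop

theorem laguerre_isBigO (k : ℕ) :
    (fun ξ : ℝ => laguerre k (2 * ξ)) =O[atTop] fun ξ => Real.exp (1 / 4 * ξ) := by
  unfold laguerre
  refine Asymptotics.IsBigO.fun_sum (A := fun (i : ℕ) (ξ : ℝ) =>
    (-1) ^ i * (k.choose i : ℝ) * (2 * ξ) ^ i / (i.factorial : ℝ)) fun i _ => ?_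
  have h : (fun ξ : ℝ => ξ ^ i) =O[atTop] fun ξ => Real.exp (1 / 4 * ξ) :=
    (isLittleO_pow_exp_pos_mul_atTop i (by norm_num : (0 : ℝ) < 1 / 4)).isBigO
  refine (h.const_mul_left ((-1) ^ i * (k.choose i : ℝ) * 2 ^ i / (i.factorial : ℝ))).congr_left
    fun ξ => ?_
  rw [mul_pow]; ring

theorem memLp_waveletHat (k : ℕ) : MemLp (waveletHat k) 2 (volume : Measure ℝ) := by
  have hc : Continuous fun ξ : ℝ => Real.sqrt (2 * ξ) * laguerreFun k (2 * ξ) := by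
    have := continuous_laguerre k
    unfold laguerreFun; fun_prop
  unfold waveletHat
  rw [memLp_indicator_iff_restrict measurableSet_Ioi]
  have hm : AEStronglyMeasurable
      (fun ξ : ℝ => ((Real.sqrt (2 * ξ) * laguerreFun k (2 * ξ) : ℝ) : ℂ))
      (volume.restrict (Ioi 0)) :=
    (Complex.continuous_ofReal.comp hc).aestronglyMeasurable
  rw [memLp_two_iff_integrable_sq_norm hm]
  have hO : (fun ξ : ℝ => 2 * ξ * laguerreFun k (2 * ξ) ^ 2) =O[atTop]
      fun ξ => Real.exp (-1 * ξ) := by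
    have h1 : (fun ξ : ℝ => ξ ^ 1) =O[atTop] fun ξ => Real.exp (1 / 2 * ξ) :=
      (isLittleO_pow_exp_pos_mul_atTop 1 (by norm_num : (0 : ℝ) < 1 / 2)).isBigO
    have h2 := laguerre_isBigO k
    have h3 := ((h1.const_mul_left 2).mul (h2.mul h2)).mul
      (Asymptotics.isBigO_refl (fun ξ : ℝ => Real.exp (-2 * ξ)) atTop)
    refine h3.congr (fun ξ => ?_) (fun ξ => ?_)
    · unfold laguerreFun
      rw [mul_pow, ← Real.exp_nat_mul]
      have : ((2 : ℕ) : ℝ) * (-(2 * ξ) / 2) = -2 * ξ := by push_cast; ring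
      rw [this]; ring
    · simp only [← Real.exp_add]
      congr 1; ring
  have hI := integrable_of_isBigO_exp_neg (a := 0) (b := 1) one_pos
    (f := fun ξ : ℝ => 2 * ξ * laguerreFun k (2 * ξ) ^ 2)
    (by have := continuous_laguerre k; unfold laguerreFun; fun_prop) hO
  refine hI.congr_fun (fun ξ hξ => ?_) measurableSet_Ioi
  have hξ' : (0 : ℝ) ≤ 2 * ξ := by have : (0 : ℝ) < ξ := hξ; linarith
  simp only [Complex.norm_real, Real.norm_eq_abs, sq_abs, mul_pow, Real.sq_sqrt hξ']

/-- The wavelet `ψ^{(k)} ∈ L₂(ℝ)`, given by its (unitary) Fourier transform. -/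
def wavelet (k : ℕ) : Lp ℂ 2 (volume : Measure ℝ) := 𝓕⁻ ((memLp_waveletHat k).toLp (waveletHat k))

/-- The dilation `ψ_v(x) = v^{-1/2} ψ(x / v)`. -/
def dilate (ψ : ℝ → ℂ) (v : ℝ) (x : ℝ) : ℂ := (((Real.sqrt v)⁻¹ : ℝ) : ℂ) * ψ (x / v)

/-- The continuous wavelet transform `(W_k f)(u, v) = (f * ψ^{(k)}_v)(u)`. -/
def waveletTransform (k : ℕ) (f : Lp ℂ 2 (volume : Measure ℝ)) (z : ℝ × ℝ) : ℂ :=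
  (⇑f ⋆[ContinuousLinearMap.mul ℂ ℂ] dilate (wavelet k) z.2) z.1

/-- The Hardy space `H₂⁺(ℝ)`. -/
def hardy : Submodule ℂ (Lp ℂ 2 (volume : Measure ℝ)) where
  carrier := {f | ∀ᵐ ξ : ℝ, ξ < 0 → (𝓕 f : Lp ℂ 2 (volume : Measure ℝ)) ξ = 0}
  zero_mem' := by
    have h0 : (𝓕 (0 : Lp ℂ 2 (volume : Measure ℝ)) : Lp ℂ 2 (volume : Measure ℝ)) = 0 :=
      (Lp.fourierTransformₗᵢ ℝ ℂ).map_zero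
    simp only [mem_ofPred_eq, h0]
    filter_upwards [Lp.coeFn_zero ℂ 2 (volume : Measure ℝ)] with ξ hξ _
    rw [hξ]; rfl
  add_mem' := by
    intro f g hf hg
    simp only [mem_ofPred_eq] at hf hg ⊢
    rw [FourierTransform.fourier_add]
    filter_upwards [hf, hg, Lp.coeFn_add (𝓕 f : Lp ℂ 2 (volume : Measure ℝ)) (𝓕 g)]
      with ξ h1 h2 h3 h
    rw [h3, Pi.add_apply, h1 h, h2 h, add_zero]
  smul_mem' := by
    intro c f hf
    simp only [mem_ofPred_eq] at hf ⊢
    rw [FourierTransform.fourier_smul]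
    filter_upwards [hf, Lp.coeFn_smul c (𝓕 f : Lp ℂ 2 (volume : Measure ℝ))] with ξ h1 h3 h
    rw [h3, Pi.smul_apply, h1 h, smul_zero]

theorem haarG_snd_pos : ∀ᵐ z ∂haarG, 0 < z.2 := by
  have h : ∀ᵐ v ∂(((volume : Measure ℝ).restrict (Ioi 0)).withDensity
      fun v => ENNReal.ofReal (v ^ 2)⁻¹), 0 < v :=
    (withDensity_absolutelyContinuous _ _).ae_le (ae_restrict_mem measurableSet_Ioi)
  exact Measure.quasiMeasurePreserving_snd.ae h

theorem convolutionExists_dilate (k : ℕ) (f : Lp ℂ 2 (volume : Measure ℝ)) {v : ℝ} (hv : 0 < v)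
    (u : ℝ) :
    ConvolutionExistsAt (⇑f) (dilate (wavelet k) v) u (ContinuousLinearMap.mul ℂ ℂ) := by
  have hq : Measure.QuasiMeasurePreserving (fun x : ℝ => (u - x) / v) volume volume := by
    have h1 : Measure.QuasiMeasurePreserving (fun x : ℝ => u - x) volume volume :=
      (Measure.measurePreserving_sub_left volume u).quasiMeasurePreserving
    have h2 : Measure.QuasiMeasurePreserving (fun x : ℝ => v⁻¹ * x) volume volume := by
      refine ⟨measurable_const_mul _, ?_⟩
      rw [Real.map_volume_mul_left (inv_ne_zero hv.ne')]
      exact Measure.smul_absolutelyContinuous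
    have h3 := h2.comp h1
    have he : (fun x : ℝ => (u - x) / v) = (fun x : ℝ => v⁻¹ * x) ∘ fun x => u - x := by
      funext x
      simp [div_eq_inv_mul]
    rw [he]
    exact h3
  have hψ : MemLp (fun x : ℝ => (wavelet k) ((u - x) / v)) 2 volume := by
    have hw := Lp.memLp (wavelet k)
    have hm : AEStronglyMeasurable (fun x : ℝ => (wavelet k) ((u - x) / v)) volume :=
      hw.1.comp_quasiMeasurePreserving hq
    rw [memLp_two_iff_integrable_sq_norm hm]
    have hi := (memLp_two_iff_integrable_sq_norm hw.1).1 hw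
    exact (hi.comp_div hv.ne').comp_sub_left u
  have h2 := (Lp.memLp f).integrable_mul (hψ.const_mul (((Real.sqrt v)⁻¹ : ℝ) : ℂ))
  exact h2

/-- The wavelet subspace `A^{(k)} = {W_k f : f ∈ H₂⁺(ℝ)}` of `L₂(G, dν)`. -/
def waveletSpace (k : ℕ) : Submodule ℂ L2G where
  carrier := {F | ∃ f ∈ hardy, ⇑F =ᵐ[haarG] waveletTransform k f}
  zero_mem' := by
    refine ⟨0, hardy.zero_mem, ?_⟩
    filter_upwards [Lp.coeFn_zero ℂ 2 haarG] with z hz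
    rw [hz]
    have h : (⇑(0 : Lp ℂ 2 (volume : Measure ℝ)) : ℝ → ℂ) =ᵐ[volume] 0 := Lp.coeFn_zero _ _ _
    simp only [waveletTransform, convolution_def, Pi.zero_apply]
    refine (integral_eq_zero_of_ae ?_).symm
    filter_upwards [h] with x hx
    simp
  add_mem' := by
    rintro F G ⟨f, hf, hF⟩ ⟨g, hg, hG⟩
    refine ⟨f + g, hardy.add_mem hf hg, ?_⟩
    filter_upwards [Lp.coeFn_add F G, hF, hG, haarG_snd_pos] with z h1 h2 h3 h4
    rw [h1, Pi.add_apply, h2, h3]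
    have e := (convolutionExists_dilate k f h4 z.1).add_distrib
      (convolutionExists_dilate k g h4 z.1)
    simp only [waveletTransform]
    rw [← e]
    simp only [convolution_def]
    refine integral_congr_ae ?_
    filter_upwards [Lp.coeFn_add f g] with x hx
    rw [hx]
  smul_mem' := by
    rintro c F ⟨f, hf, hF⟩
    refine ⟨c • f, hardy.smul_mem c hf, ?_⟩
    filter_upwards [Lp.coeFn_smul c F, hF] with z h1 h2
    rw [h1, Pi.smul_apply, h2]
    simp only [waveletTransform, convolution_def]
    rw [← integral_smul]
    refine integral_congr_ae ?_
    filter_upwards [Lp.coeFn_smul c f] with x hx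
    rw [hx]
    simp [mul_assoc]

/-- The operator `M_c` of pointwise multiplication by an essentially bounded function `c`. -/
def mulOp (c : ℝ × ℝ → ℂ) (hc : MemLp c ∞ haarG) : L2G →L[ℂ] L2G :=
  (ContinuousLinearMap.mul ℂ ℂ).holderL haarG ∞ 2 2 (hc.toLp c)

/-- The Calderón–Toeplitz operator `T_c^{(k)} = P^{(k)} M_c : A^{(k)} → A^{(k)}`, where `P^{(k)}` is
the orthogonal projection of `L₂(G, dν)` onto `A^{(k)}`. -/
def calderonToeplitz (k : ℕ) [(waveletSpace k).HasOrthogonalProjection] (c : ℝ × ℝ → ℂ)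
    (hc : MemLp c ∞ haarG) : waveletSpace k →L[ℂ] waveletSpace k :=
  (waveletSpace k).orthogonalProjectionOnto ∘L mulOp c hc ∘L (waveletSpace k).subtypeL

/-- The compound symbol
`𝔠_k(ξ, t, u) = 2 √(tξ) b(u) ∫_{ℝ₊} a(v) ℓ_k(2vξ) ℓ_k(2vt) dv`. -/
def compoundSymbol (k : ℕ) (a b : ℝ → ℂ) (ξ t u : ℝ) : ℂ :=
  2 * (Real.sqrt (t * ξ) : ℂ) * b u *
    ∫ v in Ioi (0 : ℝ), a v * (laguerreFun k (2 * v * ξ) : ℂ) * (laguerreFun k (2 * v * t) : ℂ)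

/-- The integrand `𝔠(ξ, t, u) f(t) e^{-2πi(ξ-t)u}`. -/
def psdoIntegrand (σ : ℝ → ℝ → ℝ → ℂ) (f : ℝ → ℂ) (ξ t u : ℝ) : ℂ :=
  σ ξ t u * f t * Complex.exp (-2 * Real.pi * Complex.I * ((ξ - t : ℝ) : ℂ) * (u : ℂ))

/-- `C` is the pseudo-differential operator on `L₂(ℝ₊)` with compound symbol `σ`, that is,
`(C f)(ξ) = ∫_ℝ du ∫_{ℝ₊} σ(ξ, t, u) f(t) e^{-2πi(ξ-t)u} dt`.

For test functions both integrals are absolutely convergent Lebesgue integrals. For a general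
`f ∈ L₂(ℝ₊)` they are improper: the truncated iterated integrals, over `r ≤ u ≤ s` and `0 < t ≤ M`,
converge as `M → ∞` for almost every `ξ`, and the limits converge to `C f` in `L₂(ℝ₊)` as
`r → -∞` and `s → ∞`. -/
structure IsPseudoDiffOp (σ : ℝ → ℝ → ℝ → ℂ) (C : L2Pos →L[ℂ] L2Pos) : Prop where
  test : ∀ φ : ℝ → ℂ, ContDiff ℝ ∞ φ → HasCompactSupport φ → tsupport φ ⊆ Ioi 0 →
    ∀ f : L2Pos, ⇑f =ᵐ[volume.restrict (Ioi 0)] φ →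
    ∀ᵐ ξ ∂(volume : Measure ℝ).restrict (Ioi 0),
      (∀ᵐ u : ℝ, IntegrableOn (fun t => psdoIntegrand σ φ ξ t u) (Ioi 0)) ∧
      Integrable (fun u : ℝ => ∫ t in Ioi (0 : ℝ), psdoIntegrand σ φ ξ t u) ∧
      C f ξ = ∫ u : ℝ, ∫ t in Ioi (0 : ℝ), psdoIntegrand σ φ ξ t u
  improper : ∀ f : L2Pos, ∃ g : ℝ × ℝ → L2Pos,
    (∀ r s : ℝ, ∀ᵐ ξ ∂(volume : Measure ℝ).restrict (Ioi 0),
      (∀ M : ℝ, (∀ᵐ u : ℝ, IntegrableOn (fun t => psdoIntegrand σ f ξ t u) (Ioc 0 M)) ∧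
        IntegrableOn (fun u : ℝ => ∫ t in Ioc 0 M, psdoIntegrand σ f ξ t u) (Icc r s)) ∧
      Tendsto (fun M : ℝ => ∫ u in Icc r s, ∫ t in Ioc 0 M, psdoIntegrand σ f ξ t u) atTop
        (𝓝 (g (r, s) ξ))) ∧
    Tendsto g (atBot ×ˢ atTop) (𝓝 (C f))

end CalderonToeplitz

end

namespace CalderonToeplitz

/-! On the frequency side the wavelet transform is the integral operator `V` from `L₂(ℝ₊)` to `L₂(G,
dν)` with kernel `v √(2t) ℓ_k(2vt) e^{2πiut}` (`waveletTransform_eq`). Plancherel in `u`, Tonelli,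
and `∫ 2t ℓ_k(2tv)² dv = 1` make `V` an isometry (`eLpNorm_waveletIntegral`), and its range is the
wavelet subspace (`range_waveletIsometry`). So the subspace is closed and the Calderón–Toeplitz
operator is unitarily equivalent to `V* M_c V` (`exists_unitary_compression`).

It remains to compute `V* M_c V`. If `b` lies in `L¹ ∩ L²`, Fubini gives the kernel `K(ξ, t) b̂(ξ -
t)`, where `K` is the `v`-integral with its factor `2√(tξ)` (`symbolOp_ae_eq`). Exponential decay of
`ℓ_k` and the AM-GM inequality bound `K` uniformly, so each row of the kernel is in `L²` and acts on
all of `L²` by an absolutely convergent integral. For bounded `b`, cut off to `[r, s]`: the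
truncated multiplication operators converge strongly, which is precisely the improper meaning of the
iterated integral.

For a test function `φ`, `K(ξ, ·) φ` is smooth with compact support, because `K(ξ, ·)` is a finite
combination of Laplace transforms (`contDiffOn_symbolKernel`). Its inverse Fourier transform is
Schwartz, so the outer integral converges absolutely. Only the product `a(v)b(u)` is assumed
measurable and bounded; slicing it yields good representatives of the factors
(`exists_measurable_bounded_symbol`). -/

/-! ### Laguerre functions: normalization and exponential decay. -/

/-- As a function of `i`, `(i + j)! / i!` is a monic polynomial of degree `j`, and the alternating
binomial sum is up to sign its `k`-th forward difference: zero for `j < k`, and `k!` for `j = k`. -/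
theorem sum_neg_one_pow_choose_mul_factorial_div {k j : ℕ} (hj : j ≤ k) :
    ∑ i ∈ Finset.range (k + 1),
      (-1 : ℝ) ^ i * (k.choose i : ℝ) * (((i + j).factorial : ℝ) / (i.factorial : ℝ)) =
      if j = k then (-1) ^ k * (k.factorial : ℝ) else 0 := by
  have hs : ∑ i ∈ Finset.range (k + 1),
      (-1 : ℝ) ^ i * (k.choose i : ℝ) * (((i + j).factorial : ℝ) / (i.factorial : ℝ)) =
      (-1) ^ k * (fwdDiff (1 : ℝ))^[k] (ascPochhammer ℝ j).eval 1 := by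
    rw [fwdDiff_iter_eq_sum_shift, Finset.mul_sum]
    refine Finset.sum_congr rfl fun i hi => ?_
    have hik : i ≤ k := by simpa [Nat.lt_succ_iff] using hi
    have h1 : (ascPochhammer ℝ j).eval (1 + i • (1 : ℝ)) =
        ((i + j).factorial : ℝ) / (i.factorial : ℝ) := by
      have h2 := ascPochhammer_nat_eq_natCast_ascFactorial ℝ (i + 1) j
      rw [eq_div_iff (by positivity), mul_comm, ← Nat.factorial_mul_ascFactorial]
      push_cast at h2 ⊢
      rw [← h2, nsmul_eq_mul, mul_one, add_comm (1 : ℝ)]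
    rw [h1, zsmul_eq_mul]
    push_cast
    rw [← mul_assoc, ← mul_assoc, ← pow_add]
    congr 2
    rw [show k + (k - i) = i + 2 * (k - i) by omega, pow_add, pow_mul]
    simp
  rw [hs]
  split_ifs with h
  · subst h
    have := (ascPochhammer ℝ j).fwdDiff_iter_degree_eq_factorial
    rw [ascPochhammer_natDegree, (monic_ascPochhammer ℝ j).leadingCoeff] at this
    rw [this]
    simp
  · rw [Polynomial.fwdDiff_iter_eq_zero_of_degree_lt]
    · simp
    · rw [ascPochhammer_natDegree]; omega

theorem integrableOn_pow_mul_exp_neg (n : ℕ) :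
    IntegrableOn (fun y : ℝ => y ^ n * Real.exp (-y)) (Ioi 0) := by
  have h := Real.GammaIntegral_convergent (s := n + 1) (by positivity)
  refine h.congr_fun (fun y _ => ?_) measurableSet_Ioi
  simp [mul_comm]

theorem integral_pow_mul_exp_neg (n : ℕ) :
    ∫ y in Ioi (0 : ℝ), y ^ n * Real.exp (-y) = n.factorial := by
  rw [← Real.Gamma_nat_eq_factorial, Real.Gamma_eq_integral (by positivity)]
  refine setIntegral_congr_fun measurableSet_Ioi fun y _ => ?_
  simp [mul_comm]

theorem continuous_laguerreFun (k : ℕ) : Continuous (laguerreFun k) := by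
  have := continuous_laguerre k
  unfold laguerreFun; fun_prop

theorem laguerreFun_sq_eq_sum (k : ℕ) (y : ℝ) :
    laguerreFun k y ^ 2 = ∑ j ∈ Finset.range (k + 1), ∑ i ∈ Finset.range (k + 1),
      ((-1) ^ j * (k.choose j : ℝ) / (j.factorial : ℝ)) *
        (((-1) ^ i * (k.choose i : ℝ) / (i.factorial : ℝ)) * (y ^ (i + j) * Real.exp (-y))) := by
  have h : laguerreFun k y ^ 2 = Real.exp (-y) * (laguerre k y * laguerre k y) := by
    rw [laguerreFun, mul_pow, ← Real.exp_nat_mul, sq (laguerre k y)]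
    congr 2
    push_cast; ring
  rw [h, laguerre, Finset.sum_mul_sum, Finset.mul_sum]
  refine Finset.sum_congr rfl fun j _ => ?_
  rw [Finset.mul_sum]
  refine Finset.sum_congr rfl fun i _ => ?_
  rw [pow_add]
  ring

theorem integrableOn_laguerreFun_sq (k : ℕ) :
    IntegrableOn (fun y : ℝ => laguerreFun k y ^ 2) (Ioi 0) := by
  simp_rw [laguerreFun_sq_eq_sum]
  refine integrable_finsetSum _ fun j _ => integrable_finsetSum _ fun i _ => ?_
  exact ((integrableOn_pow_mul_exp_neg _).const_mul _).const_mul _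

/-- Expanding one factor at fixed index `j` of the other leaves the finite-difference sum, so only
`j = k` survives and the leading coefficient `(-1)^k / k!` meets `(-1)^k k!`. -/
theorem integral_laguerreFun_sq (k : ℕ) :
    ∫ y in Ioi (0 : ℝ), laguerreFun k y ^ 2 = 1 := by
  have hI (i j : ℕ) := integrableOn_pow_mul_exp_neg (i + j)
  simp_rw [laguerreFun_sq_eq_sum]
  rw [integral_finsetSum _ fun j _ => integrable_finsetSum _ fun i _ =>
    ((hI i j).const_mul _).const_mul _]
  have h1 (j : ℕ) (hj : j ∈ Finset.range (k + 1)) :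
      ∫ y in Ioi (0 : ℝ), ∑ i ∈ Finset.range (k + 1),
        ((-1) ^ j * (k.choose j : ℝ) / (j.factorial : ℝ)) *
        (((-1) ^ i * (k.choose i : ℝ) / (i.factorial : ℝ)) * (y ^ (i + j) * Real.exp (-y))) =
      if j = k then 1 else 0 := by
    rw [integral_finsetSum _ fun i _ => ((hI i j).const_mul _).const_mul _]
    simp_rw [integral_const_mul, integral_pow_mul_exp_neg]
    rw [← Finset.mul_sum]
    have h2 := sum_neg_one_pow_choose_mul_factorial_div
      (k := k) (j := j) (by simpa [Nat.lt_succ_iff] using hj)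
    have h3 : ∑ i ∈ Finset.range (k + 1),
        (-1 : ℝ) ^ i * (k.choose i : ℝ) / (i.factorial : ℝ) * ((i + j).factorial : ℝ) =
        if j = k then (-1) ^ k * (k.factorial : ℝ) else 0 := by
      rw [← h2]
      exact Finset.sum_congr rfl fun i _ => by ring
    rw [h3]
    split_ifs with h
    · subst h
      have : (j.factorial : ℝ) ≠ 0 := by positivity
      have h4 : (-1 : ℝ) ^ j * (-1) ^ j = 1 := by rw [← mul_pow]; simp
      simp only [Nat.choose_self, Nat.cast_one, mul_one]
      field_simp
      linarith
    · simp
  rw [Finset.sum_congr rfl h1]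
  simp

/-- Laguerre functions decay exponentially on the half-line. -/
theorem exists_abs_laguerreFun_le (k : ℕ) :
    ∃ A : ℝ, 0 < A ∧ ∀ y : ℝ, 0 ≤ y → |laguerreFun k y| ≤ A * Real.exp (-y / 4) := by
  have h1 (y : ℝ) (hy : 0 ≤ y) : |laguerreFun k y| ≤
      (∑ i ∈ Finset.range (k + 1), (k.choose i : ℝ) * 4 ^ i) * Real.exp (-y / 4) := by
    have h2 : |laguerre k y| ≤
        (∑ i ∈ Finset.range (k + 1), (k.choose i : ℝ) * 4 ^ i) * Real.exp (y / 4) := by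
      rw [laguerre, Finset.sum_mul]
      refine (Finset.abs_sum_le_sum_abs _ _).trans (Finset.sum_le_sum fun i _ => ?_)
      -- Scaling by 4 costs the factor `4 ^ i` but bounds each monomial by `e^{y/4}`, half of what
      -- the weight `e^{-y/2}` can absorb.
      have h3 := Real.pow_div_factorial_le_exp (y / 4) (by positivity) i
      have h4 : |(-1) ^ i * (k.choose i : ℝ) * y ^ i / (i.factorial : ℝ)| =
          (k.choose i : ℝ) * 4 ^ i * ((y / 4) ^ i / (i.factorial : ℝ)) := by
        rw [abs_div, abs_mul, abs_mul, abs_pow, abs_neg, abs_one, one_pow, one_mul, Nat.abs_cast,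
          Nat.abs_cast, abs_of_nonneg (pow_nonneg hy i), div_pow]
        field_simp
      rw [h4]
      gcongr
    rw [laguerreFun, abs_mul, abs_of_pos (Real.exp_pos _)]
    calc Real.exp (-y / 2) * |laguerre k y| ≤ Real.exp (-y / 2) *
        ((∑ i ∈ Finset.range (k + 1), (k.choose i : ℝ) * 4 ^ i) * Real.exp (y / 4)) := by gcongr
      _ = _ := by
        rw [mul_left_comm, ← Real.exp_add]
        congr 2; ring
  refine ⟨_, ?_, h1⟩
  exact Finset.sum_pos' (fun i _ => by positivity)
    ⟨0, by simp, by simp⟩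

/-- The constant in the exponential bound for `ℓ_k`. -/
noncomputable def laguerreConst (k : ℕ) : ℝ := (exists_abs_laguerreFun_le k).choose

theorem laguerreConst_pos (k : ℕ) : 0 < laguerreConst k :=
  (exists_abs_laguerreFun_le k).choose_spec.1

theorem abs_laguerreFun_le (k : ℕ) {y : ℝ} (hy : 0 ≤ y) :
    |laguerreFun k y| ≤ laguerreConst k * Real.exp (-y / 4) :=
  (exists_abs_laguerreFun_le k).choose_spec.2 y hy

/-! ### The Fourier transform on `L²` and the Fourier integral. -/

section Fourier

theorem fourierInv_eq_integral_exp (h : ℝ → ℂ) (w : ℝ) :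
    𝓕⁻ h w = ∫ t : ℝ, Complex.exp (2 * Real.pi * Complex.I * w * t) * h t := by
  rw [Real.fourierInv_eq']
  refine integral_congr_ae (ae_of_all _ fun t => ?_)
  simp only [RCLike.inner_apply, conj_trivial, smul_eq_mul]
  congr 2
  push_cast; ring

theorem fourier_eq_integral_exp (h : ℝ → ℂ) (w : ℝ) :
    𝓕 h w = ∫ t : ℝ, Complex.exp (-2 * Real.pi * Complex.I * w * t) * h t := by
  rw [Real.fourier_eq']
  refine integral_congr_ae (ae_of_all _ fun t => ?_)
  simp only [RCLike.inner_apply, conj_trivial, smul_eq_mul]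
  congr 2
  push_cast; ring

theorem continuous_fourier {h : ℝ → ℂ} (h1 : Integrable h) : Continuous (𝓕 h : ℝ → ℂ) :=
  VectorFourier.fourierIntegral_continuous Real.continuous_fourierChar
    (by exact continuous_inner) h1

theorem integral_fourier_mul_eq {f g : ℝ → ℂ} (hf : Integrable f) (hg : Integrable g) :
    ∫ x, 𝓕 f x * g x = ∫ x, f x * 𝓕 g x := by
  have := VectorFourier.integral_fourierIntegral_smul_eq_flip (L := innerₗ ℝ)
    Real.continuous_fourierChar (by exact continuous_inner) hf hg
  rw [flip_innerₗ] at this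
  exact this

/-- On `L¹ ∩ L²` the Fourier transform of `L²` is given by the Fourier integral. -/
theorem fourier_toLp_ae_eq {h : ℝ → ℂ} (h1 : Integrable h) (h2 : MemLp h 2) :
    ⇑(𝓕 (h2.toLp h) : Lp ℂ 2 (volume : Measure ℝ)) =ᵐ[volume] 𝓕 h := by
  refine ae_eq_of_integral_contDiff_smul_eq ((Lp.memLp _).locallyIntegrable (by norm_num))
    (continuous_fourier h1).locallyIntegrable fun g hg hc => ?_
  have hg₁ : HasCompactSupport (Complex.ofRealCLM ∘ g) := hc.comp_left rfl
  have hg₂ : ContDiff ℝ ∞ (Complex.ofRealCLM ∘ g) := by fun_prop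
  set φ := hg₁.toSchwartzMap hg₂
  -- The `L²` transform agrees with the distributional one, whose pairing with `φ` is defined by
  -- moving the transform to `φ`; the `L¹` multiplication formula then moves it back onto `h` as an
  -- integral.
  have e1 := congrArg (fun T => T φ) (Lp.fourier_toTemperedDistribution_eq (h2.toLp h))
  simp only [TemperedDistribution.fourier_apply, Lp.toTemperedDistribution_apply] at e1
  have e2 : ∫ x, g x • (𝓕 (h2.toLp h) : Lp ℂ 2 (volume : Measure ℝ)) x =
      ∫ x, φ x • (𝓕 (h2.toLp h) : Lp ℂ 2 (volume : Measure ℝ)) x := by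
    refine integral_congr_ae (ae_of_all _ fun x => ?_)
    simp [φ]
  rw [e2, ← e1]
  have e3 := integral_fourier_mul_eq (f := φ) φ.integrable h1
  calc ∫ x, (𝓕 φ) x • (h2.toLp h) x = ∫ x, 𝓕 (φ : ℝ → ℂ) x * h x := by
        refine integral_congr_ae ?_
        filter_upwards [h2.coeFn_toLp] with x hx
        rw [hx, SchwartzMap.fourier_coe, smul_eq_mul]
    _ = ∫ x, φ x * 𝓕 h x := e3
    _ = ∫ x, g x • 𝓕 h x := by
        refine integral_congr_ae (ae_of_all _ fun x => ?_)
        simp [φ]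

theorem fourierInv_toLp_ae_eq {h : ℝ → ℂ} (h1 : Integrable h) (h2 : MemLp h 2) :
    ⇑(𝓕⁻ (h2.toLp h) : Lp ℂ 2 (volume : Measure ℝ)) =ᵐ[volume] 𝓕⁻ h := by
  have hF : Continuous (𝓕⁻ h : ℝ → ℂ) := by
    rw [Real.fourierInv_eq_fourier_comp_neg]
    exact continuous_fourier h1.comp_neg
  refine ae_eq_of_integral_contDiff_smul_eq ((Lp.memLp _).locallyIntegrable (by norm_num))
    hF.locallyIntegrable fun g hg hc => ?_
  have hg₁ : HasCompactSupport (Complex.ofRealCLM ∘ g) := hc.comp_left rfl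
  have hg₂ : ContDiff ℝ ∞ (Complex.ofRealCLM ∘ g) := by fun_prop
  set φ := hg₁.toSchwartzMap hg₂
  have e1 := congrArg (fun T => T φ) (Lp.fourierInv_toTemperedDistribution_eq (h2.toLp h))
  simp only [TemperedDistribution.fourierInv_apply, Lp.toTemperedDistribution_apply] at e1
  have e2 : ∫ x, g x • (𝓕⁻ (h2.toLp h) : Lp ℂ 2 (volume : Measure ℝ)) x =
      ∫ x, φ x • (𝓕⁻ (h2.toLp h) : Lp ℂ 2 (volume : Measure ℝ)) x := by
    refine integral_congr_ae (ae_of_all _ fun x => ?_)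
    simp [φ]
  rw [e2, ← e1]
  have e3 := integral_fourier_mul_eq (f := φ) φ.integrable h1.comp_neg
  -- The inverse transform is the forward transform of the reflected test function, so the
  -- multiplication formula is used for the reflection.
  have e4 := integral_fourier_mul_eq (f := fun x => φ (-x)) φ.integrable.comp_neg h1
  calc ∫ x, (𝓕⁻ φ) x • (h2.toLp h) x = ∫ x, 𝓕 (fun x => φ (-x)) x * h x := by
        refine integral_congr_ae ?_
        filter_upwards [h2.coeFn_toLp] with x hx
        rw [hx, SchwartzMap.fourierInv_coe, Real.fourierInv_eq_fourier_comp_neg, smul_eq_mul]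
    _ = ∫ x, φ (-x) * 𝓕 h x := e4
    _ = ∫ x, φ x * 𝓕 h (-x) := by
        rw [← integral_neg_eq_self]
        simp
    _ = ∫ x, g x • 𝓕⁻ h x := by
        refine integral_congr_ae (ae_of_all _ fun x => ?_)
        simp [φ, Real.fourierInv_eq_fourier_neg]

/-- Plancherel's theorem for the inverse Fourier integral on `L¹ ∩ L²`. -/
theorem eLpNorm_fourierInv_eq {h : ℝ → ℂ} (h1 : Integrable h) (h2 : MemLp h 2) :
    eLpNorm (𝓕⁻ h) 2 volume = eLpNorm h 2 volume := by
  rw [← eLpNorm_congr_ae (fourierInv_toLp_ae_eq h1 h2), ← eLpNorm_congr_ae h2.coeFn_toLp]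
  rw [← ENNReal.toReal_eq_toReal_iff' (Lp.eLpNorm_ne_top _) (Lp.eLpNorm_ne_top _),
    ← Lp.norm_def, ← Lp.norm_def]
  exact (Lp.fourierTransformₗᵢ ℝ ℂ).symm.norm_map _

theorem memLp_fourier {h : ℝ → ℂ} (h1 : Integrable h) (h2 : MemLp h 2) : MemLp (𝓕 h) 2 :=
  (Lp.memLp _).ae_eq (fourier_toLp_ae_eq h1 h2)

/-- The multiplication formula for the Fourier transform on `L²`. -/
theorem integral_fourier_mul_eq_of_Lp (f h : Lp ℂ 2 (volume : Measure ℝ)) :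
    ∫ x, (𝓕 f : Lp ℂ 2 (volume : Measure ℝ)) x * h x =
      ∫ x, f x * (𝓕 h : Lp ℂ 2 (volume : Measure ℝ)) x := by
  set B := (ContinuousLinearMap.mul ℂ ℂ).lpPairing (volume : Measure ℝ) 2 2
  have hB (x y : Lp ℂ 2 (volume : Measure ℝ)) : B x y = ∫ t, x t * y t := by
    simp [B, ContinuousLinearMap.lpPairing_eq_integral]
  rw [← hB, ← hB]
  -- Both sides are continuous in `h`, and on the dense set of Schwartz functions the identity is
  -- the duality defining the transform of the distribution `f`.
  refine DenseRange.induction_on (p := fun h => B (𝓕 f) h = B f (𝓕 h))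
    (SchwartzMap.denseRange_toLpCLM (F := ℂ) (p := 2) ENNReal.ofNat_ne_top) h ?_ fun φ => ?_
  · exact isClosed_eq (B (𝓕 f)).continuous
      ((B f).continuous.comp (Lp.fourierTransformₗᵢ ℝ ℂ).continuous)
  · have e1 := congrArg (fun T => T φ) (Lp.fourier_toTemperedDistribution_eq f)
    simp only [TemperedDistribution.fourier_apply, Lp.toTemperedDistribution_apply] at e1
    rw [hB, hB, SchwartzMap.toLpCLM_apply, SchwartzMap.toLp_fourier_eq]
    calc _ = ∫ x, φ x • (𝓕 f : Lp ℂ 2 (volume : Measure ℝ)) x := by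
          refine integral_congr_ae ?_
          filter_upwards [φ.coeFn_toLp 2 volume] with x hx
          rw [hx, smul_eq_mul, mul_comm]
      _ = ∫ x, (𝓕 φ) x • f x := e1.symm
      _ = _ := by
          refine integral_congr_ae ?_
          filter_upwards [(𝓕 φ).coeFn_toLp 2 volume] with x hx
          rw [hx, smul_eq_mul, mul_comm]

end Fourier

/-! ### The wavelet transform on the frequency side. -/

/-- The kernel `v √(2t) ℓ_k(2vt) e^{2πiut}` of the wavelet transform on the frequency side. -/
noncomputable def waveletKernel (k : ℕ) (z : ℝ × ℝ) (t : ℝ) : ℂ :=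
  ((z.2 * Real.sqrt (2 * t) * laguerreFun k (2 * z.2 * t) : ℝ) : ℂ) *
    Complex.exp (2 * Real.pi * Complex.I * z.1 * t)

theorem norm_exp_two_pi_I_mul (u t : ℝ) :
    ‖Complex.exp (2 * Real.pi * Complex.I * u * t)‖ = 1 := by
  rw [show 2 * Real.pi * Complex.I * u * t = ((2 * Real.pi * u * t : ℝ) : ℂ) * Complex.I by
    push_cast; ring, Complex.norm_exp_ofReal_mul_I]

theorem continuous_waveletKernel (k : ℕ) :
    Continuous fun p : (ℝ × ℝ) × ℝ => waveletKernel k p.1 p.2 := by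
  have := continuous_laguerreFun k
  unfold waveletKernel; fun_prop

theorem norm_waveletKernel (k : ℕ) {z : ℝ × ℝ} (hz : 0 < z.2) (t : ℝ) :
    ‖waveletKernel k z t‖ = z.2 * Real.sqrt (2 * t) * |laguerreFun k (2 * z.2 * t)| := by
  rw [waveletKernel, norm_mul, norm_exp_two_pi_I_mul, mul_one, Complex.norm_real,
    Real.norm_eq_abs, abs_mul, abs_of_nonneg (by positivity)]

theorem norm_waveletKernel_le (k : ℕ) {z : ℝ × ℝ} (hz : 0 < z.2) {t : ℝ} (ht : 0 < t) :
    ‖waveletKernel k z t‖ ≤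
      laguerreConst k * z.2 * Real.sqrt (2 * t) * Real.exp (-(t * z.2) / 2) := by
  rw [norm_waveletKernel k hz]
  have h := abs_laguerreFun_le k (y := 2 * z.2 * t) (by positivity)
  calc _ ≤ z.2 * Real.sqrt (2 * t) * (laguerreConst k * Real.exp (-(2 * z.2 * t) / 4)) := by
        gcongr
    _ = _ := by
        rw [show -(2 * z.2 * t) / 4 = -(t * z.2) / 2 by ring]; ring

/-- Half of the decay `e^{-tv/2}` is spent on absorbing `√t`, through `v√(2t) = √(8v) √(vt/4)` and
`√x ≤ e^x`. What remains is bounded and integrable in `t`, so the kernel is in both `L¹` and `L²`.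
-/
theorem norm_waveletKernel_le_sqrt (k : ℕ) {z : ℝ × ℝ} (hz : 0 < z.2) {t : ℝ} (ht : 0 < t) :
    ‖waveletKernel k z t‖ ≤
      laguerreConst k * Real.sqrt (8 * z.2) * Real.exp (-(z.2 / 4) * t) := by
  have hA := laguerreConst_pos k
  have h1 : z.2 * Real.sqrt (2 * t) = Real.sqrt (8 * z.2) * Real.sqrt (z.2 / 4 * t) := by
    rw [← Real.sqrt_mul (by positivity), show 8 * z.2 * (z.2 / 4 * t) = z.2 ^ 2 * (2 * t) by ring,
      Real.sqrt_mul (sq_nonneg z.2), Real.sqrt_sq hz.le]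
  have h2 : Real.sqrt (z.2 / 4 * t) ≤ Real.exp (z.2 / 4 * t) := by
    have h3 : 0 ≤ z.2 / 4 * t := by positivity
    rw [Real.sqrt_le_left (Real.exp_pos _).le]
    have h4 := Real.add_one_le_exp (z.2 / 4 * t)
    nlinarith
  refine (norm_waveletKernel_le k hz ht).trans ?_
  rw [mul_assoc (laguerreConst k), h1]
  calc _ ≤ laguerreConst k * (Real.sqrt (8 * z.2) * Real.exp (z.2 / 4 * t)) *
        Real.exp (-(t * z.2) / 2) := by gcongr
    _ = laguerreConst k * Real.sqrt (8 * z.2) *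
        (Real.exp (z.2 / 4 * t) * Real.exp (-(t * z.2) / 2)) := by ring
    _ = _ := by
        rw [← Real.exp_add]
        congr 2; ring

theorem integrableOn_waveletKernel (k : ℕ) {z : ℝ × ℝ} (hz : 0 < z.2) :
    IntegrableOn (waveletKernel k z) (Ioi 0) := by
  have h : IntegrableOn (fun t => laguerreConst k * Real.sqrt (8 * z.2) *
      Real.exp (-(z.2 / 4) * t)) (Ioi 0) :=
    (integrableOn_exp_mul_Ioi (by linarith) 0).const_mul _
  refine Integrable.mono' h ?_ ?_
  · exact ((continuous_waveletKernel k).comp (by fun_prop :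
      Continuous fun t : ℝ => (z, t))).aestronglyMeasurable
  · filter_upwards [ae_restrict_mem measurableSet_Ioi] with t ht
    exact norm_waveletKernel_le_sqrt k hz ht

theorem norm_waveletKernel_le_const (k : ℕ) {z : ℝ × ℝ} (hz : 0 < z.2) {t : ℝ} (ht : 0 < t) :
    ‖waveletKernel k z t‖ ≤ laguerreConst k * Real.sqrt (8 * z.2) := by
  have hA := laguerreConst_pos k
  refine (norm_waveletKernel_le_sqrt k hz ht).trans (mul_le_of_le_one_right (by positivity) ?_)
  rw [Real.exp_le_one_iff, neg_mul]
  have : 0 ≤ z.2 / 4 * t := by positivity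
  linarith

theorem aestronglyMeasurable_waveletKernel (k : ℕ) (z : ℝ × ℝ) (μ : Measure ℝ) :
    AEStronglyMeasurable (waveletKernel k z) μ :=
  ((continuous_waveletKernel k).comp (by fun_prop :
      Continuous fun t : ℝ => (z, t))).aestronglyMeasurable

theorem memLp_waveletKernel (k : ℕ) {z : ℝ × ℝ} (hz : 0 < z.2) :
    MemLp (waveletKernel k z) 2 (volume.restrict (Ioi 0)) := by
  have hm := aestronglyMeasurable_waveletKernel k z (volume.restrict (Ioi 0))
  rw [memLp_two_iff_integrable_sq_norm hm]
  refine ((integrableOn_waveletKernel k hz).norm.const_mul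
    (laguerreConst k * Real.sqrt (8 * z.2))).mono' (hm.norm.pow 2) ?_
  filter_upwards [ae_restrict_mem measurableSet_Ioi] with t ht
  rw [Real.norm_of_nonneg (by positivity), sq]
  gcongr
  exact norm_waveletKernel_le_const k hz ht

theorem waveletHat_eq (k : ℕ) : waveletHat k = (Ioi (0 : ℝ)).indicator (waveletKernel k (0, 1)) := by
  funext ξ
  simp [waveletHat, waveletKernel, indicator]

theorem wavelet_ae_eq (k : ℕ) : ⇑(wavelet k) =ᵐ[volume] 𝓕⁻ (waveletHat k) := by
  refine fourierInv_toLp_ae_eq ?_ (memLp_waveletHat k)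
  rw [waveletHat_eq, integrable_indicator_iff measurableSet_Ioi]
  exact integrableOn_waveletKernel k one_pos

/-- The substitution `ξ = vx` turns dilation by `v` into dilation of the frequency variable, and the
shift by `u` into the oscillating factor. Thus the second factor of the convolution is itself a
Fourier transform. -/
theorem dilate_fourierInv_waveletHat (k : ℕ) (u : ℝ) {v : ℝ} (hv : 0 < v) (t : ℝ) :
    dilate (𝓕⁻ (waveletHat k)) v (u - t) =
      𝓕 ((Ioi (0 : ℝ)).indicator (waveletKernel k (u, v))) t := by
  rw [dilate, fourierInv_eq_integral_exp, fourier_eq_integral_exp]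
  rw [← Real.sqrt_inv]
  have hv' : 0 < v⁻¹ := by positivity
  have h := Measure.integral_comp_mul_left (fun ξ : ℝ =>
    Complex.exp (2 * Real.pi * Complex.I * ((u - t) / v : ℝ) * ξ) * waveletHat k ξ) v
  rw [abs_of_pos hv'] at h
  have h2 : ∫ ξ : ℝ, Complex.exp (2 * Real.pi * Complex.I * ((u - t) / v : ℝ) * ξ) *
      waveletHat k ξ = (v : ℂ) * ∫ x : ℝ,
      Complex.exp (2 * Real.pi * Complex.I * ((u - t) / v : ℝ) * (v * x : ℝ)) *
        waveletHat k (v * x) := by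
    rw [h, Complex.real_smul, ← mul_assoc, ← Complex.ofReal_mul, mul_inv_cancel₀ hv.ne']
    simp
  rw [h2, ← mul_assoc, ← integral_const_mul]
  refine integral_congr_ae (ae_of_all _ fun x => ?_)
  have hvx : v * x ∈ Ioi (0 : ℝ) ↔ x ∈ Ioi (0 : ℝ) := by simp [hv]
  simp only [waveletHat, indicator, hvx]
  split_ifs with hx
  · have hs : Real.sqrt (2 * (v * x)) = Real.sqrt v * Real.sqrt (2 * x) := by
      rw [← Real.sqrt_mul hv.le]; congr 1; ring
    have hs2 : (Real.sqrt v⁻¹)⁻¹ = Real.sqrt v := by rw [Real.sqrt_inv, inv_inv]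
    -- The factor `v^{-1/2}` of the dilation, the Jacobian `v`, and the `√v` from `√(2vx)` combine
    -- to the factor `v` of the kernel.
    have hs3 : Real.sqrt v⁻¹ * v * Real.sqrt v = v := by
      rw [Real.sqrt_inv]
      have := (Real.sqrt_pos.2 hv).ne'
      field_simp
    have hs4 : ((Real.sqrt v⁻¹ : ℝ) : ℂ) * v * (Real.sqrt v : ℝ) = v := by exact_mod_cast hs3
    have he : Complex.exp (2 * Real.pi * Complex.I * ((u - t) / v : ℝ) * (v * x : ℝ)) =
        Complex.exp (-2 * Real.pi * Complex.I * t * x) *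
          Complex.exp (2 * Real.pi * Complex.I * u * x) := by
      rw [← Complex.exp_add]
      congr 1
      have : (v : ℂ) ≠ 0 := by exact_mod_cast hv.ne'
      push_cast
      field_simp
      ring
    rw [he, hs, waveletKernel, show 2 * (v * x) = 2 * v * x by ring]
    push_cast
    linear_combination (Complex.exp (-2 * Real.pi * Complex.I * t * x) *
          Complex.exp (2 * Real.pi * Complex.I * u * x) * (Real.sqrt (2 * x) : ℝ) *
          (laguerreFun k (2 * v * x) : ℝ)) * hs4
  · simp

/-- The wavelet transform on the frequency side. -/
theorem waveletTransform_eq (k : ℕ) (f : Lp ℂ 2 (volume : Measure ℝ)) {z : ℝ × ℝ} (hz : 0 < z.2) :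
    waveletTransform k f z = ∫ t in Ioi (0 : ℝ),
      waveletKernel k z t * (𝓕 f : Lp ℂ 2 (volume : Measure ℝ)) t := by
  obtain ⟨u, v⟩ := z
  simp only at hz
  have hi : Integrable ((Ioi (0 : ℝ)).indicator (waveletKernel k (u, v))) :=
    (integrable_indicator_iff measurableSet_Ioi).2 (integrableOn_waveletKernel k hz)
  have h2 : MemLp ((Ioi (0 : ℝ)).indicator (waveletKernel k (u, v))) 2 :=
    (memLp_indicator_iff_restrict measurableSet_Ioi).2 (memLp_waveletKernel k hz)
  have hq : Measure.QuasiMeasurePreserving (fun x : ℝ => (u - x) / v) volume volume := by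
    have h1 : Measure.QuasiMeasurePreserving (fun x : ℝ => u - x) volume volume :=
      (Measure.measurePreserving_sub_left volume u).quasiMeasurePreserving
    have h2 : Measure.QuasiMeasurePreserving (fun x : ℝ => v⁻¹ * x) volume volume := by
      refine ⟨measurable_const_mul _, ?_⟩
      rw [Real.map_volume_mul_left (inv_ne_zero hz.ne')]
      exact Measure.smul_absolutelyContinuous
    simpa only [div_eq_inv_mul, Function.comp_def] using h2.comp h1
  have e1 : waveletTransform k f (u, v) =
      ∫ t, f t * (𝓕 (h2.toLp _) : Lp ℂ 2 (volume : Measure ℝ)) t := by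
    rw [waveletTransform, convolution_def]
    refine integral_congr_ae ?_
    filter_upwards [hq.ae (wavelet_ae_eq k), fourier_toLp_ae_eq hi h2] with t ht ht2
    rw [ht2, ← dilate_fourierInv_waveletHat k u hz, dilate, dilate, ← ht]
    rfl
  -- The multiplication formula transfers the Fourier transform from the kernel to `f`.
  rw [e1, ← integral_fourier_mul_eq_of_Lp, ← integral_indicator measurableSet_Ioi]
  refine integral_congr_ae ?_
  filter_upwards [h2.coeFn_toLp] with t ht
  rw [ht]
  simp only [indicator]
  split_ifs
  · rw [mul_comm]
  · simp

/-! ### The isometry of `L₂(ℝ₊)` onto the wavelet subspace. -/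

instance : SFinite haarG := by unfold haarG; infer_instance

/-- The integral operator with kernel `waveletKernel k`. -/
noncomputable def waveletIntegral (k : ℕ) (φ : ℝ → ℂ) (z : ℝ × ℝ) : ℂ :=
  ∫ t in Ioi (0 : ℝ), waveletKernel k z t * φ t

theorem stronglyMeasurable_waveletIntegral (k : ℕ) {φ : ℝ → ℂ} (hφ : StronglyMeasurable φ) :
    StronglyMeasurable (waveletIntegral k φ) := by
  refine StronglyMeasurable.integral_prod_right
    (f := fun (z : ℝ × ℝ) t => waveletKernel k z t * φ t) ?_
  exact (continuous_waveletKernel k).stronglyMeasurable.mul (hφ.comp_measurable measurable_snd)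

theorem waveletIntegral_congr (k : ℕ) {φ ψ : ℝ → ℂ} (h : φ =ᵐ[volume.restrict (Ioi 0)] ψ) :
    waveletIntegral k φ = waveletIntegral k ψ := by
  funext z
  refine integral_congr_ae ?_
  filter_upwards [h] with t ht
  rw [ht]

theorem integrableOn_waveletKernel_mul (k : ℕ) {φ : ℝ → ℂ}
    (hφ : MemLp φ 2 (volume.restrict (Ioi 0))) {z : ℝ × ℝ} (hz : 0 < z.2) :
    IntegrableOn (fun t => waveletKernel k z t * φ t) (Ioi 0) :=
  (memLp_waveletKernel k hz).integrable_mul hφ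

theorem memLp_waveletKernel_mul (k : ℕ) {φ : ℝ → ℂ}
    (hφ : MemLp φ 2 (volume.restrict (Ioi 0))) {z : ℝ × ℝ} (hz : 0 < z.2) :
    MemLp (fun t => waveletKernel k z t * φ t) 2 (volume.restrict (Ioi 0)) := by
  refine MemLp.of_le_mul (c := laguerreConst k * Real.sqrt (8 * z.2)) hφ
    ((aestronglyMeasurable_waveletKernel k z _).mul hφ.1) ?_
  filter_upwards [ae_restrict_mem measurableSet_Ioi] with t ht
  rw [norm_mul]
  gcongr
  exact norm_waveletKernel_le_const k hz ht

theorem waveletIntegral_eq_fourierInv (k : ℕ) (φ : ℝ → ℂ) (u v : ℝ) :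
    waveletIntegral k φ (u, v) =
      𝓕⁻ ((Ioi (0 : ℝ)).indicator fun t => waveletKernel k (0, v) t * φ t) u := by
  rw [fourierInv_eq_integral_exp, waveletIntegral, ← integral_indicator measurableSet_Ioi]
  refine integral_congr_ae (ae_of_all _ fun t => ?_)
  simp only [indicator]
  split_ifs
  · simp only [waveletKernel, Complex.ofReal_zero, mul_zero, zero_mul, Complex.exp_zero, mul_one]
    ring
  · simp

theorem lintegral_enorm_sq_eq_eLpNorm_sq {α : Type*} [MeasurableSpace α] (μ : Measure α)
    (f : α → ℂ) : ∫⁻ x, ‖f x‖ₑ ^ 2 ∂μ = eLpNorm f 2 μ ^ 2 := by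
  rw [eLpNorm_eq_lintegral_rpow_enorm_toReal two_ne_zero ENNReal.ofNat_ne_top]
  simp only [ENNReal.toReal_ofNat, ENNReal.rpow_ofNat, one_div]
  rw [← ENNReal.rpow_ofNat (n := 2) (x := (_ : ℝ≥0∞) ^ _), ← ENNReal.rpow_mul]
  simp

/-- At fixed `v` the integral is an inverse Fourier transform in `u`, so this is Plancherel; the
oscillating factor of the kernel drops out. -/
theorem lintegral_waveletIntegral_slice (k : ℕ) {φ : ℝ → ℂ}
    (hφ : MemLp φ 2 (volume.restrict (Ioi 0))) {v : ℝ} (hv : 0 < v) :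
    ∫⁻ u, ‖waveletIntegral k φ (u, v)‖ₑ ^ 2 =
      ∫⁻ t in Ioi (0 : ℝ), ‖waveletKernel k (0, v) t‖ₑ ^ 2 * ‖φ t‖ₑ ^ 2 := by
  simp_rw [waveletIntegral_eq_fourierInv]
  rw [lintegral_enorm_sq_eq_eLpNorm_sq, eLpNorm_fourierInv_eq,
    eLpNorm_indicator_eq_eLpNorm_restrict measurableSet_Ioi, ← lintegral_enorm_sq_eq_eLpNorm_sq]
  · simp_rw [enorm_mul, mul_pow]
  · rw [integrable_indicator_iff measurableSet_Ioi]
    exact integrableOn_waveletKernel_mul k hφ (z := (0, v)) hv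
  · rw [memLp_indicator_iff_restrict measurableSet_Ioi]
    exact memLp_waveletKernel_mul k hφ (z := (0, v)) hv

theorem enorm_waveletKernel_sq (k : ℕ) {v t : ℝ} (hv : 0 < v) (ht : 0 < t) :
    ENNReal.ofReal (v ^ 2)⁻¹ * ‖waveletKernel k (0, v) t‖ₑ ^ 2 =
      ENNReal.ofReal (2 * t * laguerreFun k (2 * t * v) ^ 2) := by
  rw [← ofReal_norm, ← ENNReal.ofReal_pow (norm_nonneg _),
    ← ENNReal.ofReal_mul (by positivity), norm_waveletKernel k (z := (0, v)) hv, mul_pow, mul_pow,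
    sq_abs, Real.sq_sqrt (by positivity)]
  congr 1
  simp only
  rw [show 2 * v * t = 2 * t * v by ring]
  field_simp

/-- The substitution `y = 2tv` reduces this to the normalization of `ℓ_k`. It is the admissibility
condition with constant 1, the reason why the transform is isometric without rescaling. -/
theorem lintegral_laguerreFun_sq (k : ℕ) {t : ℝ} (ht : 0 < t) :
    ∫⁻ v in Ioi (0 : ℝ), ENNReal.ofReal (2 * t * laguerreFun k (2 * t * v) ^ 2) = 1 := by
  have h2 : (0 : ℝ) < 2 * t := by positivity
  have hi : IntegrableOn (fun v : ℝ => laguerreFun k (2 * t * v) ^ 2) (Ioi 0) := by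
    have := (integrableOn_Ioi_comp_mul_left_iff (fun y => laguerreFun k y ^ 2) 0 h2).2
      (by simpa using integrableOn_laguerreFun_sq k)
    exact this
  rw [← ofReal_integral_eq_lintegral_ofReal (hi.const_mul (2 * t))
    (ae_of_all _ fun v => by positivity), integral_const_mul,
    integral_comp_mul_left_Ioi (fun y => laguerreFun k y ^ 2) 0 h2, mul_zero,
    integral_laguerreFun_sq, smul_eq_mul, mul_one, mul_inv_cancel₀ h2.ne', ENNReal.ofReal_one]

theorem lintegral_haarG {f : ℝ × ℝ → ℝ≥0∞} (hf : Measurable f) :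
    ∫⁻ z, f z ∂haarG = ∫⁻ v in Ioi (0 : ℝ), ENNReal.ofReal (v ^ 2)⁻¹ * ∫⁻ u, f (u, v) := by
  rw [haarG, lintegral_prod_symm' _ hf, lintegral_withDensity_eq_lintegral_mul _ (by fun_prop)]
  · rfl
  · exact hf.lintegral_prod_left'

theorem eLpNorm_waveletIntegral (k : ℕ) (φ : L2Pos) :
    eLpNorm (waveletIntegral k φ) 2 haarG = eLpNorm φ 2 (volume.restrict (Ioi 0)) := by
  have hφ := Lp.memLp φ
  have hm := Lp.stronglyMeasurable φ
  suffices h : eLpNorm (waveletIntegral k φ) 2 haarG ^ 2 =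
      eLpNorm φ 2 (volume.restrict (Ioi 0)) ^ 2 from
    (ENNReal.pow_right_strictMono two_ne_zero).injective h
  rw [← lintegral_enorm_sq_eq_eLpNorm_sq, ← lintegral_enorm_sq_eq_eLpNorm_sq, lintegral_haarG
    ((stronglyMeasurable_waveletIntegral k hm).measurable.enorm.pow_const 2)]
  have hκ : Measurable fun p : ℝ × ℝ => ‖waveletKernel k (0, p.1) p.2‖ₑ ^ 2 :=
    (((continuous_waveletKernel k).comp (by fun_prop :
      Continuous fun p : ℝ × ℝ => (((0 : ℝ), p.1), p.2))).measurable.enorm).pow_const 2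
  calc _ = ∫⁻ v in Ioi (0 : ℝ), ∫⁻ t in Ioi (0 : ℝ), ENNReal.ofReal (v ^ 2)⁻¹ *
        (‖waveletKernel k (0, v) t‖ₑ ^ 2 * ‖φ t‖ₑ ^ 2) := by
        refine setLIntegral_congr_fun measurableSet_Ioi fun v hv => ?_
        rw [lintegral_waveletIntegral_slice k hφ hv, lintegral_const_mul]
        exact (hκ.comp (by fun_prop : Measurable fun t : ℝ => (v, t))).mul
          (hm.measurable.enorm.pow_const 2)
    _ = ∫⁻ t in Ioi (0 : ℝ), ∫⁻ v in Ioi (0 : ℝ), ENNReal.ofReal (v ^ 2)⁻¹ *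
        (‖waveletKernel k (0, v) t‖ₑ ^ 2 * ‖φ t‖ₑ ^ 2) := by
        refine lintegral_lintegral_swap (Measurable.aemeasurable ?_)
        exact (by fun_prop : Measurable fun p : ℝ × ℝ => ENNReal.ofReal (p.1 ^ 2)⁻¹).mul
          (hκ.mul ((hm.measurable.comp measurable_snd).enorm.pow_const 2))
    _ = ∫⁻ t in Ioi (0 : ℝ), ‖φ t‖ₑ ^ 2 := by
        refine setLIntegral_congr_fun measurableSet_Ioi fun t ht => ?_
        have : ∀ v ∈ Ioi (0 : ℝ), ENNReal.ofReal (v ^ 2)⁻¹ *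
            (‖waveletKernel k (0, v) t‖ₑ ^ 2 * ‖φ t‖ₑ ^ 2) =
            ENNReal.ofReal (2 * t * laguerreFun k (2 * t * v) ^ 2) * ‖φ t‖ₑ ^ 2 := by
          intro v hv
          rw [← mul_assoc, enorm_waveletKernel_sq k hv ht]
        rw [setLIntegral_congr_fun measurableSet_Ioi this, lintegral_mul_const,
          lintegral_laguerreFun_sq k ht, one_mul]
        have := continuous_laguerreFun k
        fun_prop

theorem memLp_waveletIntegral (k : ℕ) (φ : L2Pos) : MemLp (waveletIntegral k φ) 2 haarG :=
  ⟨(stronglyMeasurable_waveletIntegral k (Lp.stronglyMeasurable φ)).aestronglyMeasurable, by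
    rw [eLpNorm_waveletIntegral]; exact Lp.eLpNorm_lt_top φ⟩

/-- The isometry of `L₂(ℝ₊)` onto the wavelet subspace. -/
noncomputable def waveletIsometry (k : ℕ) : L2Pos →ₗᵢ[ℂ] L2G where
  toFun φ := (memLp_waveletIntegral k φ).toLp _
  map_add' φ ψ := by
    rw [← MemLp.toLp_add]
    refine MemLp.toLp_congr _ _ ?_
    filter_upwards [haarG_snd_pos] with z hz
    rw [waveletIntegral_congr k (Lp.coeFn_add φ ψ), Pi.add_apply]
    simp only [waveletIntegral, Pi.add_apply, mul_add]
    exact integral_add (integrableOn_waveletKernel_mul k (Lp.memLp φ) hz)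
      (integrableOn_waveletKernel_mul k (Lp.memLp ψ) hz)
  map_smul' c φ := by
    rw [RingHom.id_apply, ← MemLp.toLp_const_smul]
    refine MemLp.toLp_congr _ _ (ae_of_all _ fun z => ?_)
    rw [waveletIntegral_congr k (Lp.coeFn_smul c φ), Pi.smul_apply]
    simp only [waveletIntegral, Pi.smul_apply, smul_eq_mul, mul_left_comm _ c]
    exact integral_const_mul _ _
  norm_map' φ := by
    simp only [LinearMap.coe_mk, AddHom.coe_mk]
    rw [Lp.norm_toLp, eLpNorm_waveletIntegral, Lp.norm_def]

theorem waveletIsometry_ae_eq (k : ℕ) (φ : L2Pos) :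
    ⇑(waveletIsometry k φ) =ᵐ[haarG] waveletIntegral k φ :=
  (memLp_waveletIntegral k φ).coeFn_toLp

theorem waveletTransform_ae_eq_waveletIntegral (k : ℕ) {f : Lp ℂ 2 (volume : Measure ℝ)}
    {φ : ℝ → ℂ}
    (h : ⇑(𝓕 f : Lp ℂ 2 (volume : Measure ℝ)) =ᵐ[volume.restrict (Ioi 0)] φ) :
    waveletTransform k f =ᵐ[haarG] waveletIntegral k φ := by
  filter_upwards [haarG_snd_pos] with z hz
  rw [waveletTransform_eq k f hz, ← waveletIntegral_congr k h]
  rfl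

/-- The transform sees only the restriction of `𝓕 f` to the half-line. Extension by zero followed by
`𝓕⁻` sends `φ` to a Hardy function with that restriction; in the other direction `𝓕 f` is
restricted. -/
theorem range_waveletIsometry (k : ℕ) :
    LinearMap.range (waveletIsometry k).toLinearMap = waveletSpace k := by
  ext F
  constructor
  · rintro ⟨φ, rfl⟩
    have hφ : MemLp ((Ioi (0 : ℝ)).indicator φ) 2 :=
      (memLp_indicator_iff_restrict measurableSet_Ioi).2 (Lp.memLp φ)
    have hF : (𝓕 (𝓕⁻ (hφ.toLp _) : Lp ℂ 2 (volume : Measure ℝ)) : Lp ℂ 2 (volume : Measure ℝ)) =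
      hφ.toLp _ := FourierTransform.fourier_fourierInv_eq _
    refine ⟨𝓕⁻ (hφ.toLp _), ?_, ?_⟩
    · change ∀ᵐ ξ : ℝ, ξ < 0 → _
      rw [hF]
      filter_upwards [hφ.coeFn_toLp] with ξ hξ hneg
      rw [hξ, indicator_of_notMem (by simpa using hneg.le)]
    · refine (waveletIsometry_ae_eq k φ).trans
        (waveletTransform_ae_eq_waveletIntegral k ?_).symm
      rw [hF]
      filter_upwards [ae_restrict_of_ae hφ.coeFn_toLp, ae_restrict_mem measurableSet_Ioi]
        with t ht hpos
      rw [ht, indicator_of_mem hpos]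
  · rintro ⟨f, -, hF⟩
    have hφ := (Lp.memLp (𝓕 f : Lp ℂ 2 (volume : Measure ℝ))).restrict (Ioi 0)
    refine ⟨hφ.toLp _, Lp.ext ?_⟩
    exact (waveletIsometry_ae_eq k _).trans
      ((waveletTransform_ae_eq_waveletIntegral k hφ.coeFn_toLp.symm).symm.trans hF.symm)

/-! ### Compression of an operator to the range of an isometry. -/

section Compression

variable {E H : Type*} [NormedAddCommGroup E] [InnerProductSpace ℂ E] [CompleteSpace E]
  [NormedAddCommGroup H] [InnerProductSpace ℂ H] [CompleteSpace H]

/-- The compression of `T` to the range of an isometry `V` is unitarily equivalent to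
`V* T V`. -/
theorem exists_unitary_compression (V : E →ₗᵢ[ℂ] H) {K : Submodule ℂ H}
    (hK : LinearMap.range V.toLinearMap = K) :
    ∃ _ : K.HasOrthogonalProjection, ∃ W : K ≃ₗᵢ[ℂ] E, ∀ (T : H →L[ℂ] H) (F : K),
      W ((K.orthogonalProjectionOnto ∘L T ∘L K.subtypeL) F) =
        (ContinuousLinearMap.adjoint V.toContinuousLinearMap ∘L T ∘L V.toContinuousLinearMap)
          (W F) := by
  subst hK
  have : CompleteSpace (LinearMap.range V.toLinearMap) :=
    V.isometry.isUniformInducing.isComplete_range.completeSpace_coe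
  refine ⟨inferInstance, V.equivRange.symm, fun T F => ?_⟩
  obtain ⟨f, rfl⟩ := V.equivRange.surjective F
  -- Tested against `h`, both sides equal `⟪V h, T V f⟫`: the projection disappears because `V h`
  -- lies in the range.
  refine ext_inner_left ℂ fun h => ?_
  rw [LinearIsometryEquiv.symm_apply_apply, ← V.equivRange.inner_map_map,
    LinearIsometryEquiv.apply_symm_apply]
  simp only [ContinuousLinearMap.coe_comp, Function.comp_apply,
    ContinuousLinearMap.adjoint_inner_right]
  rw [Submodule.inner_orthogonalProjectionOnto_eq_of_mem_left]
  rfl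

end Compression

/-! ### Dominated convergence, multiplication operators and the weight `v⁻² dv`. -/

/-- Dominated convergence in `L²`. -/
theorem tendsto_Lp_two_of_dominated {α ι : Type*} [MeasurableSpace α] {μ : Measure α}
    {l : Filter ι} [l.IsCountablyGenerated] {F : ι → Lp ℂ 2 μ} {G : Lp ℂ 2 μ} {f : ι → α → ℂ}
    {g : α → ℂ} (hF : ∀ i, ⇑(F i) =ᵐ[μ] f i) (hG : ⇑G =ᵐ[μ] g) {H : α → ℂ} (hH : MemLp H 2 μ)
    (hf : ∀ i, ∀ᵐ x ∂μ, ‖f i x‖ ≤ ‖H x‖) (hg : ∀ᵐ x ∂μ, ‖g x‖ ≤ ‖H x‖)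
    (hlim : ∀ᵐ x ∂μ, Tendsto (fun i => f i x) l (𝓝 (g x))) :
    Tendsto F l (𝓝 G) := by
  rw [Lp.tendsto_Lp_iff_tendsto_eLpNorm']
  have h1 : Tendsto (fun i => ∫⁻ x, ‖f i x - g x‖ₑ ^ 2 ∂μ) l (𝓝 (∫⁻ _, 0 ∂μ)) := by
    refine tendsto_lintegral_filter_of_dominated_convergence'
      (fun x => (2 * ‖H x‖ₑ) ^ 2) (Eventually.of_forall fun i => ?_)
      (Eventually.of_forall fun i => ?_) ?_ ?_
    · exact ((((Lp.memLp (F i)).1.congr (hF i)).sub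
        ((Lp.memLp G).1.congr hG)).enorm).pow_const 2
    · filter_upwards [hf i, hg] with x h1 h2
      gcongr
      rw [two_mul]
      refine (enorm_sub_le).trans (add_le_add ?_ ?_)
      · exact enorm_le_iff_norm_le.2 h1
      · exact enorm_le_iff_norm_le.2 h2
    · simp_rw [mul_pow]
      rw [lintegral_const_mul'' _ (hH.1.enorm.pow_const 2), lintegral_enorm_sq_eq_eLpNorm_sq]
      exact ENNReal.mul_ne_top (by simp) (ENNReal.pow_ne_top hH.eLpNorm_ne_top)
    · filter_upwards [hlim] with x hx
      have h2 : Tendsto (fun i => f i x - g x) l (𝓝 0) := by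
        simpa using hx.sub_const (g x)
      have h3 := (continuous_enorm.tendsto (0 : ℂ)).comp h2
      rw [enorm_zero] at h3
      have h4 := ((ENNReal.continuous_pow 2).tendsto 0).comp h3
      rwa [zero_pow two_ne_zero] at h4
  rw [lintegral_zero] at h1
  replace h1 : Tendsto (fun i => eLpNorm (fun x => f i x - g x) 2 μ ^ 2) l (𝓝 0) :=
    h1.congr fun i => lintegral_enorm_sq_eq_eLpNorm_sq μ fun x => f i x - g x
  have h2 : Tendsto (fun i => (eLpNorm (fun x => f i x - g x) 2 μ ^ 2) ^ (1 / 2 : ℝ)) l (𝓝 0) := by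
    have := (ENNReal.continuous_rpow_const (y := 1 / 2)).tendsto (0 : ℝ≥0∞)
    rw [ENNReal.zero_rpow_of_pos (by norm_num)] at this
    exact this.comp h1
  refine h2.congr fun i => ?_
  rw [← ENNReal.rpow_ofNat, ← ENNReal.rpow_mul]
  norm_num
  refine eLpNorm_congr_ae ?_
  filter_upwards [hF i, hG] with x h1 h2
  simp [h1, h2]

theorem coeFn_mulOp (c : ℝ × ℝ → ℂ) (hc : MemLp c ∞ haarG) (F : L2G) :
    ⇑(mulOp c hc F) =ᵐ[haarG] fun z => c z * F z := by
  have h := (ContinuousLinearMap.mul ℂ ℂ).coeFn_holder (r := 2) (hc.toLp c) F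
  filter_upwards [h, hc.coeFn_toLp] with z h1 h2
  rw [← h2]
  exact h1

theorem mulOp_congr {c c' : ℝ × ℝ → ℂ} (hc : MemLp c ∞ haarG) (hc' : MemLp c' ∞ haarG)
    (h : c =ᵐ[haarG] c') : mulOp c hc = mulOp c' hc' := by
  unfold mulOp
  rw [MemLp.toLp_congr hc hc' h]

/-- The weight `v⁻² dv` on the half-line. -/
noncomputable def haarWeight : Measure ℝ :=
  ((volume : Measure ℝ).restrict (Ioi 0)).withDensity fun v => ENNReal.ofReal (v ^ 2)⁻¹

theorem haarG_eq : haarG = (volume : Measure ℝ).prod haarWeight := rfl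

instance : SFinite haarWeight := by unfold haarWeight; infer_instance

theorem integrable_haarWeight_iff {g : ℝ → ℂ} :
    Integrable g haarWeight ↔ IntegrableOn (fun v : ℝ => (((v ^ 2)⁻¹ : ℝ) : ℂ) * g v) (Ioi 0) := by
  rw [haarWeight, integrable_withDensity_iff_integrable_smul' (by fun_prop)
    (ae_of_all _ fun _ => ENNReal.ofReal_lt_top)]
  refine integrable_congr (ae_of_all _ fun v => ?_)
  simp only
  rw [ENNReal.toReal_ofReal (by positivity), Complex.real_smul]

theorem integral_haarWeight (g : ℝ → ℂ) :
    ∫ v, g v ∂haarWeight = ∫ v in Ioi (0 : ℝ), (((v ^ 2)⁻¹ : ℝ) : ℂ) * g v := by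
  rw [haarWeight, integral_withDensity_eq_integral_toReal_smul (by fun_prop)
    (ae_of_all _ fun _ => ENNReal.ofReal_lt_top)]
  refine integral_congr_ae (ae_of_all _ fun v => ?_)
  simp only
  rw [ENNReal.toReal_ofReal (by positivity), Complex.real_smul]

theorem integrableOn_exp_neg_mul {δ : ℝ} (hδ : 0 < δ) :
    IntegrableOn (fun v : ℝ => Real.exp (-(δ * v))) (Ioi 0) := by
  simpa only [neg_mul] using integrableOn_exp_mul_Ioi (a := -δ) (by linarith) 0

theorem integral_exp_neg_mul {δ : ℝ} (hδ : 0 < δ) :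
    ∫ v in Ioi (0 : ℝ), Real.exp (-(δ * v)) = δ⁻¹ := by
  have := integral_exp_mul_Ioi (a := -δ) (by linarith) 0
  simp only [neg_mul, mul_zero, Real.exp_zero] at this
  rw [this]
  field_simp

/-- The common majorant for the Fubini arguments: a product of two wavelet kernels contributes `v²`,
which cancels the density `v⁻²` of the Haar measure, and one exponential makes the rest integrable.
-/
theorem integrable_haarG_dominating {b : ℝ → ℂ} (hb : Integrable b) {δ : ℝ} (hδ : 0 < δ) :
    Integrable (fun z : ℝ × ℝ => b z.1 * ((z.2 ^ 2 * Real.exp (-(δ * z.2)) : ℝ) : ℂ)) haarG := by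
  rw [haarG_eq]
  refine hb.mul_prod (g := fun v : ℝ => ((v ^ 2 * Real.exp (-(δ * v)) : ℝ) : ℂ))
    (integrable_haarWeight_iff.2 ?_)
  have h : IntegrableOn (fun v : ℝ => (Real.exp (-(δ * v)) : ℂ)) (Ioi 0) :=
    (integrableOn_exp_neg_mul hδ).ofReal
  refine h.congr_fun (fun v hv => ?_) measurableSet_Ioi
  have hv' : v ≠ 0 := (mem_Ioi.1 hv).ne'
  rw [← Complex.ofReal_mul, inv_mul_cancel_left₀ (pow_ne_zero 2 hv')]

/-! ### The kernel of `V* M_c V`. -/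

/-- The factor `2 √(tξ) ∫ a(v) ℓ_k(2vξ) ℓ_k(2vt) dv` of the compound symbol. -/
noncomputable def symbolKernel (k : ℕ) (a : ℝ → ℂ) (ξ t : ℝ) : ℂ :=
  2 * (Real.sqrt (t * ξ) : ℂ) *
    ∫ v in Ioi (0 : ℝ), a v * (laguerreFun k (2 * v * ξ) : ℂ) * (laguerreFun k (2 * v * t) : ℂ)

theorem compoundSymbol_eq (k : ℕ) (a b : ℝ → ℂ) (ξ t u : ℝ) :
    compoundSymbol k a b ξ t u = b u * symbolKernel k a ξ t := by
  rw [compoundSymbol, symbolKernel]; ring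

theorem norm_symbol_integrand_le (k : ℕ) {a : ℝ → ℂ} {A : ℝ} {v : ℝ} (ha : ‖a v‖ ≤ A)
    {ξ t : ℝ} (hξ : 0 < ξ) (ht : 0 < t) (hv : 0 < v) :
    ‖a v * (laguerreFun k (2 * v * ξ) : ℂ) * (laguerreFun k (2 * v * t) : ℂ)‖ ≤
      A * laguerreConst k ^ 2 * Real.exp (-((ξ + t) / 2 * v)) := by
  have hA : 0 ≤ A := (norm_nonneg _).trans ha
  have h0 := laguerreConst_pos k
  have h1 := abs_laguerreFun_le k (y := 2 * v * ξ) (by positivity)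
  have h2 := abs_laguerreFun_le k (y := 2 * v * t) (by positivity)
  rw [norm_mul, norm_mul, Complex.norm_real, Complex.norm_real, Real.norm_eq_abs, Real.norm_eq_abs]
  calc _ ≤ A * (laguerreConst k * Real.exp (-(2 * v * ξ) / 4)) *
        (laguerreConst k * Real.exp (-(2 * v * t) / 4)) := by gcongr
    _ = A * laguerreConst k ^ 2 *
        (Real.exp (-(2 * v * ξ) / 4) * Real.exp (-(2 * v * t) / 4)) := by ring
    _ = _ := by
      rw [← Real.exp_add]
      congr 2; ring

theorem integrableOn_symbol (k : ℕ) {a : ℝ → ℂ} {A : ℝ}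
    (ham : AEStronglyMeasurable a (volume.restrict (Ioi 0)))
    (ha : ∀ᵐ v ∂(volume : Measure ℝ).restrict (Ioi 0), ‖a v‖ ≤ A)
    {ξ t : ℝ} (hξ : 0 < ξ) (ht : 0 < t) :
    IntegrableOn (fun v => a v * (laguerreFun k (2 * v * ξ) : ℂ) *
      (laguerreFun k (2 * v * t) : ℂ)) (Ioi 0) := by
  have hl := continuous_laguerreFun k
  have h1 := (integrableOn_exp_neg_mul (δ := (ξ + t) / 2) (by linarith)).const_mul
    (A * laguerreConst k ^ 2)
  refine h1.mono' ((ham.mul (Continuous.aestronglyMeasurable (by fun_prop))).mul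
    (Continuous.aestronglyMeasurable (by fun_prop))) ?_
  filter_upwards [ae_restrict_mem measurableSet_Ioi, ha] with v hv hav
  exact norm_symbol_integrand_le k hav hξ ht hv

/-- The exponential bounds integrate to `2 / (ξ + t)`, and `2√(tξ) ≤ ξ + t` cancels the denominator.
The bound is uniform in `ξ` and `t`. -/
theorem norm_symbolKernel_le (k : ℕ) {a : ℝ → ℂ} {A : ℝ} (ha : ∀ v, ‖a v‖ ≤ A)
    {ξ t : ℝ} (hξ : 0 < ξ) (ht : 0 < t) :
    ‖symbolKernel k a ξ t‖ ≤ 2 * (A * laguerreConst k ^ 2) := by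
  have hA : 0 ≤ A := (norm_nonneg _).trans (ha 0)
  have h1 : ‖∫ v in Ioi (0 : ℝ), a v * (laguerreFun k (2 * v * ξ) : ℂ) *
      (laguerreFun k (2 * v * t) : ℂ)‖ ≤ A * laguerreConst k ^ 2 * ((ξ + t) / 2)⁻¹ := by
    rw [← integral_exp_neg_mul (δ := (ξ + t) / 2) (by linarith), ← integral_const_mul]
    refine norm_integral_le_of_norm_le
      ((integrableOn_exp_neg_mul (δ := (ξ + t) / 2) (by linarith)).const_mul _) ?_
    filter_upwards [ae_restrict_mem measurableSet_Ioi] with v hv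
    exact norm_symbol_integrand_le k (ha v) hξ ht hv
  have h2 : 2 * Real.sqrt (t * ξ) ≤ ξ + t := by
    rw [Real.sqrt_mul ht.le]
    nlinarith [sq_nonneg (Real.sqrt t - Real.sqrt ξ), Real.sq_sqrt ht.le, Real.sq_sqrt hξ.le]
  rw [symbolKernel, norm_mul, norm_mul, Complex.norm_real, Real.norm_eq_abs,
    abs_of_nonneg (Real.sqrt_nonneg _), Complex.norm_ofNat]
  calc _ ≤ (ξ + t) * (A * laguerreConst k ^ 2 * ((ξ + t) / 2)⁻¹) := by gcongr
    _ = _ := by field_simp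

theorem stronglyMeasurable_symbolKernel (k : ℕ) {a : ℝ → ℂ} (ha : Measurable a) (ξ : ℝ) :
    StronglyMeasurable (symbolKernel k a ξ) := by
  have hl := continuous_laguerreFun k
  unfold symbolKernel
  refine StronglyMeasurable.mul (Continuous.stronglyMeasurable (by fun_prop)) ?_
  refine StronglyMeasurable.integral_prod_right (f := fun (t v : ℝ) =>
    a v * (laguerreFun k (2 * v * ξ) : ℂ) * (laguerreFun k (2 * v * t) : ℂ)) ?_
  exact ((ha.comp measurable_snd).stronglyMeasurable.mul
    (Continuous.stronglyMeasurable (by fun_prop))).mul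
    (Continuous.stronglyMeasurable (by fun_prop))

theorem conj_waveletKernel_mul (k : ℕ) (a b : ℝ → ℂ) (u v : ℝ) {ξ t : ℝ} (ht : 0 < t) :
    (starRingEnd ℂ) (waveletKernel k (u, v) ξ) * (a v * b u) * waveletKernel k (u, v) t =
      (Complex.exp (-2 * Real.pi * Complex.I * ((ξ - t : ℝ) : ℂ) * u) * b u) *
        (((v ^ 2 : ℝ) : ℂ) * (2 * (Real.sqrt (t * ξ) : ℂ) *
          (a v * (laguerreFun k (2 * v * ξ) : ℂ) * (laguerreFun k (2 * v * t) : ℂ)))) := by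
  have he : (starRingEnd ℂ) (Complex.exp (2 * Real.pi * Complex.I * u * ξ)) *
      Complex.exp (2 * Real.pi * Complex.I * u * t) =
      Complex.exp (-2 * Real.pi * Complex.I * ((ξ - t : ℝ) : ℂ) * u) := by
    rw [← Complex.exp_conj, ← Complex.exp_add]
    congr 1
    simp only [map_mul, Complex.conj_ofReal, Complex.conj_I, map_ofNat]
    push_cast; ring
  have hs : ((Real.sqrt (2 * ξ) : ℝ) : ℂ) * (Real.sqrt (2 * t) : ℝ) =
      2 * (Real.sqrt (t * ξ) : ℝ) := by
    rw [← Complex.ofReal_mul, mul_comm, ← Real.sqrt_mul (by positivity),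
      show 2 * t * (2 * ξ) = 2 ^ 2 * (t * ξ) by ring, Real.sqrt_mul (by norm_num),
      Real.sqrt_sq (by norm_num)]
    push_cast; rfl
  rw [← he]
  simp only [waveletKernel, map_mul, Complex.conj_ofReal]
  push_cast
  linear_combination ((v : ℂ) ^ 2 * (laguerreFun k (2 * v * ξ) : ℂ) *
    (laguerreFun k (2 * v * t) : ℂ) * a v * b u *
    ((starRingEnd ℂ) (Complex.exp (2 * Real.pi * Complex.I * u * ξ)) *
      Complex.exp (2 * Real.pi * Complex.I * u * t))) * hs

/-- The integrand is a function of `u` times a function of `v`, so the integral over `G` splits: the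
`u`-part is the Fourier integral of `b` at `ξ - t`, and the `v`-part is the symbol kernel. -/
theorem integral_conj_waveletKernel_mul (k : ℕ) (a b : ℝ → ℂ) {ξ t : ℝ} (ht : 0 < t) :
    ∫ z, (starRingEnd ℂ) (waveletKernel k z ξ) * (a z.2 * b z.1) * waveletKernel k z t ∂haarG =
      symbolKernel k a ξ t * 𝓕 b (ξ - t) := by
  have hs : ∫ v, ((v ^ 2 : ℝ) : ℂ) * (2 * (Real.sqrt (t * ξ) : ℂ) *
      (a v * (laguerreFun k (2 * v * ξ) : ℂ) * (laguerreFun k (2 * v * t) : ℂ))) ∂haarWeight =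
      symbolKernel k a ξ t := by
    rw [integral_haarWeight, symbolKernel, ← integral_const_mul]
    refine setIntegral_congr_fun measurableSet_Ioi fun v hv => ?_
    have hv' : v ≠ 0 := (mem_Ioi.1 hv).ne'
    rw [← mul_assoc, ← Complex.ofReal_mul, inv_mul_cancel₀ (pow_ne_zero 2 hv'),
      Complex.ofReal_one, one_mul]
  calc _ = ∫ z : ℝ × ℝ, (Complex.exp (-2 * Real.pi * Complex.I * ((ξ - t : ℝ) : ℂ) * z.1) *
          b z.1) * (((z.2 ^ 2 : ℝ) : ℂ) * (2 * (Real.sqrt (t * ξ) : ℂ) *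
          (a z.2 * (laguerreFun k (2 * z.2 * ξ) : ℂ) * (laguerreFun k (2 * z.2 * t) : ℂ))))
          ∂(volume : Measure ℝ).prod haarWeight := by
        rw [haarG_eq]
        exact integral_congr_ae (ae_of_all _ fun z => conj_waveletKernel_mul k a b z.1 z.2 ht)
    _ = 𝓕 b (ξ - t) * symbolKernel k a ξ t := by
        rw [integral_prod_mul (μ := (volume : Measure ℝ)) (ν := haarWeight)
          (fun u : ℝ => Complex.exp (-2 * Real.pi * Complex.I * ((ξ - t : ℝ) : ℂ) * u) * b u)
          (fun v : ℝ => ((v ^ 2 : ℝ) : ℂ) * (2 * (Real.sqrt (t * ξ) : ℂ) *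
          (a v * (laguerreFun k (2 * v * ξ) : ℂ) * (laguerreFun k (2 * v * t) : ℂ)))), hs,
          ← fourier_eq_integral_exp b (ξ - t)]
    _ = _ := mul_comm _ _

/-! ### `V* M_c V` as an integral operator for integrable `b`. -/

/-- The operator `V* M_c V` on `L₂(ℝ₊)`, with `V` the wavelet isometry. -/
noncomputable def symbolOp (k : ℕ) (c : ℝ × ℝ → ℂ) (hc : MemLp c (∞ : ℝ≥0∞) haarG) : L2Pos →L[ℂ] L2Pos :=
  ContinuousLinearMap.adjoint (waveletIsometry k).toContinuousLinearMap ∘L mulOp c hc ∘L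
    (waveletIsometry k).toContinuousLinearMap

theorem integrableOn_of_ae_eq_zero {f : L2Pos} {δ N : ℝ}
    (hf : ∀ᵐ t ∂(volume : Measure ℝ).restrict (Ioi 0), t ∉ Ioc δ N → f t = 0) :
    IntegrableOn f (Ioi 0) := by
  have h1 : MemLp f 2 (((volume : Measure ℝ).restrict (Ioi 0)).restrict (Ioc δ N)) :=
    (Lp.memLp f).restrict _
  have : IsFiniteMeasure (((volume : Measure ℝ).restrict (Ioi 0)).restrict (Ioc δ N)) := by
    rw [Measure.restrict_restrict measurableSet_Ioc]
    exact isFiniteMeasure_restrict.2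
      ((measure_mono inter_subset_left).trans_lt measure_Ioc_lt_top).ne
  have h2 := h1.integrable (by norm_num)
  have h3 := (integrable_indicator_iff measurableSet_Ioc).2 h2
  refine h3.congr ?_
  filter_upwards [hf] with t ht
  by_cases h : t ∈ Ioc δ N
  · rw [indicator_of_mem h]
  · rw [indicator_of_notMem h, ht h]

theorem integrableOn_sqrt_mul_norm {f : L2Pos} {δ N : ℝ}
    (hf : ∀ᵐ t ∂(volume : Measure ℝ).restrict (Ioi 0), t ∉ Ioc δ N → f t = 0) :
    IntegrableOn (fun t => Real.sqrt (2 * t) * ‖f t‖) (Ioi 0) := by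
  refine ((integrableOn_of_ae_eq_zero hf).norm.const_mul (Real.sqrt (2 * N))).mono'
    ((Continuous.aestronglyMeasurable (by fun_prop)).mul (Lp.aestronglyMeasurable f).norm) ?_
  filter_upwards [hf] with t ht
  rw [Real.norm_of_nonneg (by positivity)]
  by_cases h : t ∈ Ioc δ N
  · gcongr
    exact h.2
  · simp [ht h]

/-- Frequencies above `δ` give the decay `e^{-δv/2}` in the scale; this is the purpose of cutting
`f` off near zero. -/
theorem norm_waveletIntegral_le (k : ℕ) {f : L2Pos} {δ N : ℝ}
    (hf : ∀ᵐ t ∂(volume : Measure ℝ).restrict (Ioi 0), t ∉ Ioc δ N → f t = 0)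
    {z : ℝ × ℝ} (hz : 0 < z.2) :
    ‖waveletIntegral k f z‖ ≤ laguerreConst k * z.2 * Real.exp (-(δ / 2 * z.2)) *
      ∫ t in Ioi (0 : ℝ), Real.sqrt (2 * t) * ‖f t‖ := by
  have hA := laguerreConst_pos k
  rw [← integral_const_mul]
  refine norm_integral_le_of_norm_le ((integrableOn_sqrt_mul_norm hf).const_mul _) ?_
  filter_upwards [hf, ae_restrict_mem measurableSet_Ioi] with t ht hpos
  by_cases h : t ∈ Ioc δ N
  · rw [norm_mul]
    calc _ ≤ laguerreConst k * z.2 * Real.sqrt (2 * t) * Real.exp (-(t * z.2) / 2) * ‖f t‖ := by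
          gcongr
          exact norm_waveletKernel_le k hz hpos
      _ ≤ laguerreConst k * z.2 * Real.sqrt (2 * t) * Real.exp (-(δ / 2 * z.2)) * ‖f t‖ := by
          gcongr
          have := mul_le_mul_of_nonneg_right h.1.le hz.le
          linarith
      _ = _ := by ring
  · simp [ht h]

theorem norm_waveletKernel_le_of_le (k : ℕ) {z : ℝ × ℝ} (hz : 0 < z.2) {ξ N : ℝ} (hξ : 0 < ξ)
    (hN : ξ ≤ N) : ‖waveletKernel k z ξ‖ ≤ laguerreConst k * z.2 * Real.sqrt (2 * N) := by
  have hA := laguerreConst_pos k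
  refine (norm_waveletKernel_le k hz hξ).trans ?_
  calc _ ≤ laguerreConst k * z.2 * Real.sqrt (2 * N) * 1 := by
        gcongr
        rw [Real.exp_le_one_iff]
        have : 0 ≤ ξ * z.2 := by positivity
        linarith
    _ = _ := mul_one _

section BoundedSymbol

variable {a b : ℝ → ℂ} {A : ℝ}

theorem integrable_prod_restrict_Ioc (k : ℕ) (ham : Measurable a) (ha : ∀ v, ‖a v‖ ≤ A)
    (hbm : Measurable b) (hb : Integrable b) {f : L2Pos} {δ N : ℝ} (hδ : 0 < δ)
    (hf : ∀ᵐ t ∂(volume : Measure ℝ).restrict (Ioi 0), t ∉ Ioc δ N → f t = 0)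
    {S : Set ℝ} {M : ℝ} (hS : S ⊆ Ioc 0 M) (hSm : MeasurableSet S) :
    Integrable (fun p : (ℝ × ℝ) × ℝ => (starRingEnd ℂ) (waveletKernel k p.1 p.2) *
      (a p.1.2 * b p.1.1) * waveletIntegral k f p.1) (haarG.prod (volume.restrict S)) := by
  have hA := laguerreConst_pos k
  have hA0 : 0 ≤ A := (norm_nonneg _).trans (ha 0)
  set I := ∫ t in Ioi (0 : ℝ), Real.sqrt (2 * t) * ‖f t‖
  have hI0 : 0 ≤ I := integral_nonneg fun t => by positivity
  have : IsFiniteMeasure ((volume : Measure ℝ).restrict S) :=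
    isFiniteMeasure_restrict.2 ((measure_mono hS).trans_lt measure_Ioc_lt_top).ne
  have h1 := ((integrable_haarG_dominating hb (half_pos hδ)).norm.const_mul
    (laguerreConst k ^ 2 * Real.sqrt (2 * M) * A * I)).mul_prod
    (integrable_const (μ := (volume : Measure ℝ).restrict S) (1 : ℝ))
  refine h1.mono' ?_ ?_
  · have m1 : Measurable fun p : (ℝ × ℝ) × ℝ => (starRingEnd ℂ) (waveletKernel k p.1 p.2) :=
      (Complex.continuous_conj.comp (continuous_waveletKernel k)).measurable
    have m2 := (stronglyMeasurable_waveletIntegral k (Lp.stronglyMeasurable f)).measurable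
    have m3 : Measurable fun p : (ℝ × ℝ) × ℝ => a p.1.2 * b p.1.1 :=
      (ham.comp (by fun_prop)).mul (hbm.comp (by fun_prop))
    exact ((m1.mul m3).mul (m2.comp measurable_fst)).aestronglyMeasurable
  · filter_upwards [Measure.quasiMeasurePreserving_fst.ae haarG_snd_pos,
      Measure.quasiMeasurePreserving_snd.ae (ae_restrict_mem hSm)] with p hp1 hp2
    have h2 := hS hp2
    rw [norm_mul, norm_mul, norm_mul, RCLike.norm_conj, norm_mul, mul_one, Complex.norm_real,
      Real.norm_of_nonneg (by positivity)]
    calc _ ≤ laguerreConst k * p.1.2 * Real.sqrt (2 * M) * (A * ‖b p.1.1‖) *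
          (laguerreConst k * p.1.2 * Real.exp (-(δ / 2 * p.1.2)) * I) := by
          gcongr
          · exact norm_waveletKernel_le_of_le k hp1 h2.1 h2.2
          · exact ha _
          · exact norm_waveletIntegral_le k hf hp1
      _ = _ := by ring

/-- Fubini in `z` and `t`. Here the decay in `v` comes from the kernel at the fixed frequency `ξ >
0`, and the support of `f` serves only to make `√(2t) |f(t)|` integrable. -/
theorem integral_conj_mul_waveletIntegral (k : ℕ) (ham : Measurable a) (ha : ∀ v, ‖a v‖ ≤ A)
    (hbm : Measurable b) (hb : Integrable b) {f : L2Pos} {δ N : ℝ}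
    (hf : ∀ᵐ t ∂(volume : Measure ℝ).restrict (Ioi 0), t ∉ Ioc δ N → f t = 0)
    {ξ : ℝ} (hξ : 0 < ξ) :
    ∫ z, (starRingEnd ℂ) (waveletKernel k z ξ) * (a z.2 * b z.1) * waveletIntegral k f z ∂haarG =
      ∫ t in Ioi (0 : ℝ), symbolKernel k a ξ t * 𝓕 b (ξ - t) * f t := by
  have hA := laguerreConst_pos k
  have hA0 : 0 ≤ A := (norm_nonneg _).trans (ha 0)
  have h1 := ((integrable_haarG_dominating hb (half_pos hξ)).norm.const_mul
    (laguerreConst k ^ 2 * Real.sqrt (2 * ξ) * A)).mul_prod (integrableOn_sqrt_mul_norm hf)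
  have h2 : Integrable (Function.uncurry fun (z : ℝ × ℝ) (t : ℝ) =>
      (starRingEnd ℂ) (waveletKernel k z ξ) * (a z.2 * b z.1) * (waveletKernel k z t * f t))
      (haarG.prod (volume.restrict (Ioi 0))) := by
    refine h1.mono' ?_ ?_
    · have m1 : Measurable fun p : (ℝ × ℝ) × ℝ => (starRingEnd ℂ) (waveletKernel k p.1 ξ) :=
        (Complex.continuous_conj.comp ((continuous_waveletKernel k).comp (by fun_prop :
          Continuous fun p : (ℝ × ℝ) × ℝ => (p.1, ξ)))).measurable
      have m2 := (continuous_waveletKernel k).measurable.mul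
        ((Lp.stronglyMeasurable f).measurable.comp measurable_snd)
      have m3 : Measurable fun p : (ℝ × ℝ) × ℝ => a p.1.2 * b p.1.1 :=
        (ham.comp (by fun_prop)).mul (hbm.comp (by fun_prop))
      exact ((m1.mul m3).mul m2).aestronglyMeasurable
    · filter_upwards [Measure.quasiMeasurePreserving_fst.ae haarG_snd_pos,
        Measure.quasiMeasurePreserving_snd.ae (ae_restrict_mem measurableSet_Ioi)] with p hp1 hp2
      simp only [Function.uncurry]
      have hp2' : 0 < p.2 := hp2
      rw [norm_mul, norm_mul, RCLike.norm_conj, norm_mul, norm_mul, norm_mul, Complex.norm_real,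
        Real.norm_of_nonneg (r := p.1.2 ^ 2 * _) (by positivity)]
      calc _ ≤ laguerreConst k * p.1.2 * Real.sqrt (2 * ξ) * Real.exp (-(ξ * p.1.2) / 2) *
            (A * ‖b p.1.1‖) * ((laguerreConst k * p.1.2 * Real.sqrt (2 * p.2)) * ‖f p.2‖) := by
            gcongr
            · exact norm_waveletKernel_le k hp1 hξ
            · exact ha _
            · exact norm_waveletKernel_le_of_le k hp1 hp2' le_rfl
        _ = _ := by
            rw [show -(ξ * p.1.2) / 2 = -(ξ / 2 * p.1.2) by ring]; ring
  calc _ = ∫ z, (∫ t in Ioi (0 : ℝ), (starRingEnd ℂ) (waveletKernel k z ξ) * (a z.2 * b z.1) *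
        (waveletKernel k z t * f t)) ∂haarG := by
        refine integral_congr_ae (ae_of_all _ fun z => ?_)
        simp only [waveletIntegral]
        rw [← integral_const_mul]
    _ = ∫ t in Ioi (0 : ℝ), ∫ z, (starRingEnd ℂ) (waveletKernel k z ξ) * (a z.2 * b z.1) *
        (waveletKernel k z t * f t) ∂haarG := integral_integral_swap h2
    _ = _ := by
        refine setIntegral_congr_fun measurableSet_Ioi fun t ht => ?_
        rw [← integral_conj_waveletKernel_mul k a b ht, ← integral_mul_const]
        refine integral_congr_ae (ae_of_all _ fun z => ?_)
        simp only
        ring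

theorem inner_indicatorConstLp_symbolOp (k : ℕ) (hc : MemLp (fun z : ℝ × ℝ => a z.2 * b z.1) (∞ : ℝ≥0∞) haarG)
    (f : L2Pos) {S : Set ℝ} (hSm : MeasurableSet S) (hS : S ⊆ Ioi 0)
    (hS' : (volume : Measure ℝ).restrict (Ioi 0) S ≠ ⊤) :
    inner ℂ (indicatorConstLp 2 hSm hS' (1 : ℂ)) (symbolOp k _ hc f) =
      ∫ z, (∫ ξ in S, (starRingEnd ℂ) (waveletKernel k z ξ) *
      (a z.2 * b z.1) * waveletIntegral k f z) ∂haarG := by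
  simp only [symbolOp, ContinuousLinearMap.coe_comp, Function.comp_apply,
    ContinuousLinearMap.adjoint_inner_right, LinearIsometry.coe_toContinuousLinearMap]
  rw [L2.inner_def]
  refine integral_congr_ae ?_
  filter_upwards [coeFn_mulOp _ hc (waveletIsometry k f), waveletIsometry_ae_eq k f,
    waveletIsometry_ae_eq k (indicatorConstLp 2 hSm hS' (1 : ℂ))] with z h1 h2 h3
  rw [h1, h2, h3, RCLike.inner_apply, waveletIntegral_congr k indicatorConstLp_coeFn]
  have h4 : waveletIntegral k (S.indicator fun _ => 1) z = ∫ ξ in S, waveletKernel k z ξ := by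
    rw [waveletIntegral, ← integral_indicator measurableSet_Ioi, ← integral_indicator hSm]
    refine integral_congr_ae (ae_of_all _ fun t => ?_)
    by_cases h : t ∈ S
    · simp [h, hS h]
    · simp [indicator, h]
  rw [h4, integral_mul_const, integral_mul_const, integral_conj]
  ring

/-- Two functions with the same integrals over measurable subsets of each `(0, M]` agree almost
everywhere. The integral of `V* M_c V f` over such a set is `⟪V 1_S, c V f⟫`, and Fubini brings out
the integration over `S`. -/
theorem symbolOp_ae_eq_of_support (k : ℕ) (ham : Measurable a) (ha : ∀ v, ‖a v‖ ≤ A)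
    (hbm : Measurable b) (hb : Integrable b)
    (hc : MemLp (fun z : ℝ × ℝ => a z.2 * b z.1) (∞ : ℝ≥0∞) haarG) {f : L2Pos} {δ N : ℝ} (hδ : 0 < δ)
    (hf : ∀ᵐ t ∂(volume : Measure ℝ).restrict (Ioi 0), t ∉ Ioc δ N → f t = 0) :
    ∀ᵐ ξ ∂(volume : Measure ℝ).restrict (Ioi 0), symbolOp k _ hc f ξ =
      ∫ t in Ioi (0 : ℝ), symbolKernel k a ξ t * 𝓕 b (ξ - t) * f t := by
  have hU : Ioi (0 : ℝ) = ⋃ n : ℕ, Ioc (0 : ℝ) n := by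
    ext x
    simp only [mem_Ioi, mem_iUnion, mem_Ioc]
    exact ⟨fun h => (exists_nat_ge x).imp fun n hn => ⟨h, hn⟩, fun ⟨n, h, _⟩ => h⟩
  set g := symbolOp k _ hc f
  have key (M : ℕ) : ∀ᵐ ξ ∂(volume : Measure ℝ).restrict (Ioc 0 M), g ξ =
      ∫ z, (starRingEnd ℂ) (waveletKernel k z ξ) * (a z.2 * b z.1) * waveletIntegral k f z
        ∂haarG := by
    have hle : (volume : Measure ℝ).restrict (Ioc 0 (M : ℝ)) ≤ volume.restrict (Ioi 0) :=
      Measure.restrict_mono Ioc_subset_Ioi_self le_rfl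
    refine Integrable.ae_eq_of_forall_setIntegral_eq _ _ ?_ ?_ fun s hs _ => ?_
    · exact ((Lp.memLp g).mono_measure hle).integrable (by norm_num)
    · exact (integrable_prod_restrict_Ioc k ham ha hbm hb hδ hf Subset.rfl
        measurableSet_Ioc).integral_prod_right
    · rw [Measure.restrict_restrict hs]
      have hS : s ∩ Ioc 0 (M : ℝ) ⊆ Ioc 0 (M : ℝ) := inter_subset_right
      have hSm : MeasurableSet (s ∩ Ioc 0 (M : ℝ)) := hs.inter measurableSet_Ioc
      have hS0 : s ∩ Ioc 0 (M : ℝ) ⊆ Ioi 0 := hS.trans Ioc_subset_Ioi_self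
      have hS' : (volume : Measure ℝ).restrict (Ioi 0) (s ∩ Ioc 0 (M : ℝ)) ≠ ⊤ := by
        rw [Measure.restrict_apply hSm]
        exact ((measure_mono (inter_subset_left.trans hS)).trans_lt measure_Ioc_lt_top).ne
      have h1 := L2.inner_indicatorConstLp_one (𝕜 := ℂ) hSm hS' g
      rw [Measure.restrict_restrict hSm, inter_eq_left.2 hS0] at h1
      rw [← h1, inner_indicatorConstLp_symbolOp k hc f hSm hS0 hS']
      exact integral_integral_swap
        (integrable_prod_restrict_Ioc k ham ha hbm hb hδ hf hS hSm)
  have h2 := (ae_restrict_iUnion_iff (fun n : ℕ => Ioc (0 : ℝ) n) _).2 key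
  rw [← hU] at h2
  filter_upwards [h2, ae_restrict_mem measurableSet_Ioi] with ξ h3 hξ
  rw [h3, integral_conj_mul_waveletIntegral k ham ha hbm hb hf hξ]

theorem memLp_symbolKernel_mul_fourier (k : ℕ) (ham : Measurable a) (ha : ∀ v, ‖a v‖ ≤ A)
    (hb : Integrable b) (hb2 : MemLp b 2) {ξ : ℝ} (hξ : 0 < ξ) :
    MemLp (fun t => symbolKernel k a ξ t * 𝓕 b (ξ - t)) 2 (volume.restrict (Ioi 0)) := by
  have h1 : MemLp (fun t => 𝓕 b (ξ - t)) 2 (volume.restrict (Ioi 0)) :=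
    ((memLp_fourier hb hb2).comp_measurePreserving
      (Measure.measurePreserving_sub_left volume ξ)).restrict _
  refine MemLp.of_le_mul (c := 2 * (A * laguerreConst k ^ 2)) h1
    ((stronglyMeasurable_symbolKernel k ham ξ).aestronglyMeasurable.mul h1.1) ?_
  filter_upwards [ae_restrict_mem measurableSet_Ioi] with t ht
  rw [norm_mul]
  gcongr
  exact norm_symbolKernel_le k ha hξ ht

theorem integrableOn_symbolKernel_mul_fourier (k : ℕ) (ham : Measurable a) (ha : ∀ v, ‖a v‖ ≤ A)
    (hb : Integrable b) (hb2 : MemLp b 2) (f : L2Pos) {ξ : ℝ} (hξ : 0 < ξ) :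
    IntegrableOn (fun t => symbolKernel k a ξ t * 𝓕 b (ξ - t) * f t) (Ioi 0) :=
  (memLp_symbolKernel_mul_fourier k ham ha hb hb2 hξ).integrable_mul (Lp.memLp f)

/-- For an integrable `b` the operator `V* M_c V` is an integral operator. -/
theorem symbolOp_ae_eq (k : ℕ) (ham : Measurable a) (ha : ∀ v, ‖a v‖ ≤ A)
    (hbm : Measurable b) (hb : Integrable b) (hb2 : MemLp b 2)
    (hc : MemLp (fun z : ℝ × ℝ => a z.2 * b z.1) (∞ : ℝ≥0∞) haarG) (f : L2Pos) :
    ∀ᵐ ξ ∂(volume : Measure ℝ).restrict (Ioi 0), symbolOp k _ hc f ξ =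
      ∫ t in Ioi (0 : ℝ), symbolKernel k a ξ t * 𝓕 b (ξ - t) * f t := by
  -- Cutoffs away from both `0` and `∞`, where the formula is known. The operator side converges
  -- almost everywhere along a subsequence; the integral side converges by domination, since each
  -- row of the kernel is in `L²`.
  set s : ℕ → Set ℝ := fun n => Ioc (1 / ((n : ℝ) + 1)) n with hs
  have hm (n : ℕ) : MemLp ((s n).indicator f) 2 (volume.restrict (Ioi 0)) :=
    (Lp.memLp f).indicator measurableSet_Ioc
  have hlim (t : ℝ) (ht : 0 < t) :
      ∀ᶠ n : ℕ in atTop, (s n).indicator f t = f t := by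
    have h1 := (tendsto_one_div_add_atTop_nhds_zero_nat (𝕜 := ℝ)).eventually (gt_mem_nhds ht)
    have h2 := tendsto_natCast_atTop_atTop.eventually (eventually_ge_atTop t)
    filter_upwards [h1, h2] with n h1 h2
    exact indicator_of_mem (show t ∈ Ioc _ _ from ⟨h1, h2⟩) _
  have hle (n : ℕ) (t : ℝ) : ‖(s n).indicator f t‖ ≤ ‖f t‖ := norm_indicator_le_norm_self _ _
  have h1 : Tendsto (fun n => (hm n).toLp _) atTop (𝓝 f) := by
    refine tendsto_Lp_two_of_dominated (fun n => (hm n).coeFn_toLp) (ae_eq_refl _) (Lp.memLp f)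
      (fun n => ae_of_all _ (hle n)) (ae_of_all _ fun _ => le_rfl) ?_
    filter_upwards [ae_restrict_mem measurableSet_Ioi] with t ht
    exact tendsto_const_nhds.congr' ((hlim t ht).mono fun n hn => hn.symm)
  have h2 : Tendsto (fun n => symbolOp k _ hc ((hm n).toLp _)) atTop (𝓝 (symbolOp k _ hc f)) :=
    ((symbolOp k _ hc).continuous.tendsto f).comp h1
  obtain ⟨ns, hns, h3⟩ := (tendstoInMeasure_of_tendsto_Lp h2).exists_seq_tendsto_ae
  have h4 : ∀ᵐ ξ ∂(volume : Measure ℝ).restrict (Ioi 0), ∀ n,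
      symbolOp k _ hc ((hm n).toLp _) ξ =
        ∫ t in Ioi (0 : ℝ), symbolKernel k a ξ t * 𝓕 b (ξ - t) * (s n).indicator f t := by
    refine ae_all_iff.2 fun n => ?_
    have h5 : ∀ᵐ t ∂(volume : Measure ℝ).restrict (Ioi 0),
        t ∉ Ioc (1 / ((n : ℝ) + 1)) n → ((hm n).toLp _ : L2Pos) t = 0 := by
      filter_upwards [(hm n).coeFn_toLp] with t ht hn
      rw [ht, indicator_of_notMem hn]
    filter_upwards [symbolOp_ae_eq_of_support k ham ha hbm hb hc (by positivity) h5] with ξ hξ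
    rw [hξ]
    refine integral_congr_ae ?_
    filter_upwards [(hm n).coeFn_toLp] with t ht
    rw [ht]
  filter_upwards [h3, h4, ae_restrict_mem measurableSet_Ioi] with ξ h5 h6 hξ
  simp only [h6] at h5
  refine tendsto_nhds_unique h5 (Tendsto.comp (g := fun n => ∫ t in Ioi (0 : ℝ),
    symbolKernel k a ξ t * 𝓕 b (ξ - t) * (s n).indicator f t) ?_ hns.tendsto_atTop)
  have hI := integrableOn_symbolKernel_mul_fourier k ham ha hb hb2 f hξ
  refine tendsto_integral_of_dominated_convergence _ (fun n => ?_) hI.norm (fun n => ?_) ?_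
  · exact (memLp_symbolKernel_mul_fourier k ham ha hb hb2 hξ).1.mul (hm n).1
  · refine ae_of_all _ fun t => ?_
    rw [norm_mul, norm_mul _ (f t)]
    gcongr
    exact hle n t
  · filter_upwards [ae_restrict_mem measurableSet_Ioi] with t ht
    refine tendsto_const_nhds.congr' ((hlim t ht).mono fun n hn => ?_)
    simp only [hn]

end BoundedSymbol

/-! ### Smoothness of Laplace transforms. -/

section Laplace

/-- The functions on the half-line with a Laplace transform on `(0, ∞)`. -/
def HasLaplace (m : ℝ → ℂ) : Prop :=
  ∀ δ : ℝ, 0 < δ → IntegrableOn (fun v : ℝ => (Real.exp (-(δ * v)) : ℂ) * m v) (Ioi 0)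

/-- Half of the exponential absorbs the factor: `v e^{-δv/2} ≤ 2/δ`. This stability is what lets
differentiation under the integral be iterated. -/
theorem HasLaplace.id_mul {m : ℝ → ℂ} (hm : HasLaplace m) : HasLaplace fun v => (v : ℂ) * m v := by
  intro δ hδ
  have h1 := hm (δ / 2) (half_pos hδ)
  have h2 := h1.bdd_mul (f := fun v : ℝ => ((v * Real.exp (-(δ / 2 * v)) : ℝ) : ℂ)) (c := 2 / δ)
    (Continuous.aestronglyMeasurable (by fun_prop)) ?_
  · refine h2.congr (ae_of_all _ fun v => ?_)
    have h3 : Real.exp (-(δ * v)) = Real.exp (-(δ / 2 * v)) * Real.exp (-(δ / 2 * v)) := by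
      rw [← Real.exp_add]; congr 1; ring
    simp only [h3]
    push_cast
    ring
  · filter_upwards [ae_restrict_mem measurableSet_Ioi] with v hv
    have hv' : 0 < v := hv
    rw [Complex.norm_real, Real.norm_of_nonneg (by positivity), Real.exp_neg, ← div_eq_mul_inv,
      div_le_div_iff₀ (Real.exp_pos _) hδ]
    have := Real.add_one_le_exp (δ / 2 * v)
    linarith

theorem HasLaplace.pow_mul {m : ℝ → ℂ} (hm : HasLaplace m) (n : ℕ) :
    HasLaplace fun v => (v : ℂ) ^ n * m v := by
  induction n with
  | zero => simpa using hm
  | succ n ih => simpa only [pow_succ', mul_assoc] using ih.id_mul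

/-- The Laplace transform. -/
noncomputable def laplace (m : ℝ → ℂ) (t : ℝ) : ℂ :=
  ∫ v in Ioi (0 : ℝ), (Real.exp (-(t * v)) : ℂ) * m v

theorem HasLaplace.hasDerivAt {m : ℝ → ℂ} (hm : HasLaplace m) {t : ℝ} (ht : 0 < t) :
    HasDerivAt (laplace m) (-laplace (fun v => (v : ℂ) * m v) t) t := by
  have h := hasDerivAt_integral_of_dominated_loc_of_deriv_le
    (μ := (volume : Measure ℝ).restrict (Ioi 0)) (𝕜 := ℝ) (s := Ioi (t / 2)) (x₀ := t)
    (F := fun t v => (Real.exp (-(t * v)) : ℂ) * m v)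
    (F' := fun t v => -((Real.exp (-(t * v)) : ℂ) * ((v : ℂ) * m v)))
    (bound := fun v => ‖(Real.exp (-(t / 2 * v)) : ℂ) * ((v : ℂ) * m v)‖)
    (Ioi_mem_nhds (by linarith)) ?_ (hm t ht) (hm.id_mul t ht).neg.1 ?_
    (hm.id_mul (t / 2) (half_pos ht)).norm ?_
  · have h2 := h.2
    rw [integral_neg] at h2
    exact h2
  · filter_upwards [lt_mem_nhds ht] with x hx
    exact (hm x hx).1
  · filter_upwards [ae_restrict_mem measurableSet_Ioi] with v hv x hx
    have hv' : 0 < v := hv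
    have hx' : t / 2 < x := hx
    rw [norm_neg, norm_mul, norm_mul _ (_ * _), Complex.norm_real, Complex.norm_real,
      Real.norm_of_nonneg (Real.exp_pos _).le, Real.norm_of_nonneg (Real.exp_pos _).le]
    gcongr
  · refine ae_of_all _ fun v x _ => ?_
    have h1 : HasDerivAt (fun x : ℝ => Real.exp (-(x * v))) (Real.exp (-(x * v)) * -v) x := by
      have := ((hasDerivAt_id x).mul_const v).neg.exp
      simpa using this
    have h2 := h1.ofReal_comp.mul_const (m v)
    exact h2.congr_deriv (by push_cast; ring)

theorem HasLaplace.contDiffOn {m : ℝ → ℂ} (hm : HasLaplace m) :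
    ContDiffOn ℝ ∞ (laplace m) (Ioi 0) := by
  rw [contDiffOn_infty]
  intro n
  induction n generalizing m with
  | zero =>
    exact contDiffOn_zero.2 fun t ht => (hm.hasDerivAt ht).continuousAt.continuousWithinAt
  | succ n ih =>
    push_cast
    rw [contDiffOn_succ_iff_deriv_of_isOpen isOpen_Ioi]
    refine ⟨fun t ht => (hm.hasDerivAt ht).differentiableAt.differentiableWithinAt, by simp, ?_⟩
    exact (ih hm.id_mul).neg.congr fun t ht => (hm.hasDerivAt ht).deriv

end Laplace

/-! ### Bounded symbols: truncation in `u` and the improper integral. -/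

section BoundedSymbol

variable {a b : ℝ → ℂ} {A B : ℝ}

/-- Since `ℓ_k(2vt)` is `e^{-tv}` times a polynomial in `tv`, the `v`-integral is a finite sum of
powers of `t` times Laplace transforms of `v^i a(v) ℓ_k(2vξ)`. -/
theorem contDiffOn_symbolKernel (k : ℕ) (ham : Measurable a) (ha : ∀ v, ‖a v‖ ≤ A) {ξ : ℝ}
    (hξ : 0 < ξ) : ContDiffOn ℝ ∞ (symbolKernel k a ξ) (Ioi 0) := by
  have hl := continuous_laguerreFun k
  have hA0 : 0 ≤ A := (norm_nonneg _).trans (ha 0)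
  have hm : HasLaplace fun v => a v * (laguerreFun k (2 * v * ξ) : ℂ) := by
    intro δ hδ
    have h1 : IntegrableOn (fun v : ℝ => (Real.exp (-(δ * v)) : ℂ)) (Ioi 0) :=
      (integrableOn_exp_neg_mul hδ).ofReal
    refine h1.mul_bdd (c := A * laguerreConst k) (ham.aestronglyMeasurable.mul
      (Continuous.aestronglyMeasurable (by fun_prop))) ?_
    filter_upwards [ae_restrict_mem measurableSet_Ioi] with v hv
    have hv' : 0 < v := hv
    have h2 := abs_laguerreFun_le k (y := 2 * v * ξ) (by positivity)
    have h3 : Real.exp (-(2 * v * ξ) / 4) ≤ 1 := by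
      rw [Real.exp_le_one_iff]
      have : 0 ≤ 2 * v * ξ := by positivity
      linarith
    rw [norm_mul, Complex.norm_real, Real.norm_eq_abs]
    gcongr
    · exact ha v
    · exact h2.trans (mul_le_of_le_one_right (laguerreConst_pos k).le h3)
  have he (t : ℝ) (ht : t ∈ Ioi (0 : ℝ)) : symbolKernel k a ξ t =
      ((2 * Real.sqrt (t * ξ) : ℝ) : ℂ) * ∑ i ∈ Finset.range (k + 1),
        (((-1) ^ i * (k.choose i : ℝ) * (2 * t) ^ i / (i.factorial : ℝ) : ℝ) : ℂ) *
        laplace (fun v => (v : ℂ) ^ i * (a v * (laguerreFun k (2 * v * ξ) : ℂ))) t := by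
    have h1 (v : ℝ) : a v * (laguerreFun k (2 * v * ξ) : ℂ) * (laguerreFun k (2 * v * t) : ℂ) =
        ∑ i ∈ Finset.range (k + 1),
        (((-1) ^ i * (k.choose i : ℝ) * (2 * t) ^ i / (i.factorial : ℝ) : ℝ) : ℂ) *
        ((Real.exp (-(t * v)) : ℂ) * ((v : ℂ) ^ i * (a v * (laguerreFun k (2 * v * ξ) : ℂ)))) := by
      have h2 : laguerreFun k (2 * v * t) = ∑ i ∈ Finset.range (k + 1),
          ((-1) ^ i * (k.choose i : ℝ) * (2 * t) ^ i / (i.factorial : ℝ)) *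
            (Real.exp (-(t * v)) * v ^ i) := by
        rw [laguerreFun, laguerre, Finset.mul_sum]
        refine Finset.sum_congr rfl fun i _ => ?_
        rw [show -(2 * v * t) / 2 = -(t * v) by ring, show 2 * v * t = 2 * t * v by ring,
          mul_pow (2 * t)]
        ring
      rw [h2, Complex.ofReal_sum, Finset.mul_sum]
      refine Finset.sum_congr rfl fun i _ => ?_
      push_cast
      ring
    rw [symbolKernel]
    simp_rw [h1]
    rw [integral_finsetSum _ fun i _ => ((hm.pow_mul i) t ht).const_mul _]
    simp_rw [integral_const_mul]
    rw [Complex.ofReal_mul, Complex.ofReal_ofNat]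
    rfl
  refine ContDiffOn.congr ?_ he
  refine ContDiffOn.mul ?_ (ContDiffOn.sum fun i _ => ContDiffOn.mul ?_ (hm.pow_mul i).contDiffOn)
  · refine Complex.ofRealCLM.contDiff.comp_contDiffOn (contDiffOn_const.mul ?_)
    refine ContDiffOn.sqrt (by fun_prop) fun t ht => ?_
    exact (mul_pos ht hξ).ne'
  · refine Complex.ofRealCLM.contDiff.comp_contDiffOn (ContDiff.contDiffOn ?_)
    refine ContDiff.div_const ?_ _
    fun_prop

theorem memLp_top_symbol (ham : Measurable a) (ha : ∀ v, ‖a v‖ ≤ A) (hbm : Measurable b)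
    (hb : ∀ u, ‖b u‖ ≤ B) : MemLp (fun z : ℝ × ℝ => a z.2 * b z.1) (⊤ : ℝ≥0∞) haarG := by
  have hA0 : 0 ≤ A := (norm_nonneg _).trans (ha 0)
  refine memLp_top_of_bound ((ham.comp measurable_snd).mul
    (hbm.comp measurable_fst)).aestronglyMeasurable (A * B) (ae_of_all _ fun z => ?_)
  rw [norm_mul]
  gcongr
  · exact ha _
  · exact hb _

theorem norm_indicator_symbol_le (hb : ∀ u, ‖b u‖ ≤ B) (s : Set ℝ) (u : ℝ) :
    ‖s.indicator b u‖ ≤ B :=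
  (norm_indicator_le_norm_self _ _).trans (hb u)

theorem integrable_indicator_Icc (hbm : Measurable b) (hb : ∀ u, ‖b u‖ ≤ B) (r s : ℝ) :
    Integrable ((Icc r s).indicator b) := by
  rw [integrable_indicator_iff measurableSet_Icc]
  exact IntegrableOn.of_bound measure_Icc_lt_top hbm.aestronglyMeasurable B
    (ae_of_all _ hb)

theorem memLp_two_indicator_Icc (hbm : Measurable b) (hb : ∀ u, ‖b u‖ ≤ B) (r s : ℝ) :
    MemLp ((Icc r s).indicator b) 2 := by
  rw [memLp_indicator_iff_restrict measurableSet_Icc]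
  have : IsFiniteMeasure ((volume : Measure ℝ).restrict (Icc r s)) :=
    isFiniteMeasure_restrict.2 measure_Icc_lt_top.ne
  exact MemLp.of_bound hbm.aestronglyMeasurable B (ae_of_all _ hb)

theorem psdoIntegrand_compoundSymbol (k : ℕ) (a b φ : ℝ → ℂ) (ξ t u : ℝ) :
    psdoIntegrand (compoundSymbol k a b) φ ξ t u =
      (Complex.exp (-2 * Real.pi * Complex.I * ((ξ - t : ℝ) : ℂ) * u) * b u) *
        (symbolKernel k a ξ t * φ t) := by
  rw [psdoIntegrand, compoundSymbol_eq]; ring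

theorem norm_exp_neg_two_pi_I_mul (x u : ℝ) :
    ‖Complex.exp (-2 * Real.pi * Complex.I * x * u)‖ = 1 := by
  rw [show -2 * Real.pi * Complex.I * x * u = ((-2 * Real.pi * x * u : ℝ) : ℂ) * Complex.I by
    push_cast; ring, Complex.norm_exp_ofReal_mul_I]

theorem norm_psdoIntegrand_le (k : ℕ) (ha : ∀ v, ‖a v‖ ≤ A) (hb : ∀ u, ‖b u‖ ≤ B) (φ : ℝ → ℂ)
    {ξ t : ℝ} (hξ : 0 < ξ) (ht : 0 < t) (u : ℝ) :
    ‖psdoIntegrand (compoundSymbol k a b) φ ξ t u‖ ≤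
      B * (2 * (A * laguerreConst k ^ 2)) * ‖φ t‖ := by
  have hB0 : 0 ≤ B := (norm_nonneg _).trans (hb 0)
  rw [psdoIntegrand_compoundSymbol, norm_mul, norm_mul, norm_exp_neg_two_pi_I_mul, one_mul,
    norm_mul, mul_assoc]
  gcongr
  · exact hb u
  · exact norm_symbolKernel_le k ha hξ ht

theorem measurable_psdoIntegrand (k : ℕ) (ham : Measurable a) (hbm : Measurable b) {φ : ℝ → ℂ}
    (hφ : Measurable φ) (ξ : ℝ) :
    Measurable fun p : ℝ × ℝ => psdoIntegrand (compoundSymbol k a b) φ ξ p.2 p.1 := by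
  simp_rw [psdoIntegrand_compoundSymbol]
  have h1 := (stronglyMeasurable_symbolKernel k ham ξ).measurable
  exact ((Continuous.measurable (by fun_prop)).mul (hbm.comp measurable_fst)).mul
    ((h1.comp measurable_snd).mul (hφ.comp measurable_snd))

theorem integrableOn_psdoIntegrand (k : ℕ) (ham : Measurable a) (ha : ∀ v, ‖a v‖ ≤ A)
    (hbm : Measurable b) (hb : ∀ u, ‖b u‖ ≤ B) {φ : ℝ → ℂ} (hφ : Measurable φ) {S : Set ℝ}
    (hSm : MeasurableSet S) (hS : S ⊆ Ioi 0) (hφi : IntegrableOn φ S) {ξ : ℝ} (hξ : 0 < ξ)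
    (u : ℝ) : IntegrableOn (fun t => psdoIntegrand (compoundSymbol k a b) φ ξ t u) S := by
  refine (hφi.norm.const_mul (B * (2 * (A * laguerreConst k ^ 2)))).mono'
    ((measurable_psdoIntegrand k ham hbm hφ ξ).comp
      (by fun_prop : Measurable fun t : ℝ => (u, t))).aestronglyMeasurable ?_
  filter_upwards [ae_restrict_mem hSm] with t ht
  exact norm_psdoIntegrand_le k ha hb φ hξ (hS ht) u

theorem integrable_prod_psdoIntegrand (k : ℕ) (ham : Measurable a) (ha : ∀ v, ‖a v‖ ≤ A)
    (hbm : Measurable b) (hb : ∀ u, ‖b u‖ ≤ B) {φ : ℝ → ℂ} (hφ : Measurable φ) {S : Set ℝ}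
    (hSm : MeasurableSet S) (hS : S ⊆ Ioi 0) (hφi : IntegrableOn φ S) {ξ : ℝ} (hξ : 0 < ξ)
    (r s : ℝ) :
    Integrable (Function.uncurry fun u t => psdoIntegrand (compoundSymbol k a b) φ ξ t u)
      ((volume.restrict (Icc r s)).prod (volume.restrict S)) := by
  have : IsFiniteMeasure ((volume : Measure ℝ).restrict (Icc r s)) :=
    isFiniteMeasure_restrict.2 measure_Icc_lt_top.ne
  refine ((integrable_const (μ := (volume : Measure ℝ).restrict (Icc r s))
    (B * (2 * (A * laguerreConst k ^ 2)))).mul_prod hφi.norm).mono'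
    (measurable_psdoIntegrand k ham hbm hφ ξ).aestronglyMeasurable ?_
  filter_upwards [Measure.quasiMeasurePreserving_snd.ae (ae_restrict_mem hSm)] with p hp
  exact norm_psdoIntegrand_le k ha hb φ hξ (hS hp) p.1

theorem integral_psdoIntegrand_swap (k : ℕ) (ham : Measurable a) (ha : ∀ v, ‖a v‖ ≤ A)
    (hbm : Measurable b) (hb : ∀ u, ‖b u‖ ≤ B) {φ : ℝ → ℂ} (hφ : Measurable φ) {S : Set ℝ}
    (hSm : MeasurableSet S) (hS : S ⊆ Ioi 0) (hφi : IntegrableOn φ S) {ξ : ℝ} (hξ : 0 < ξ)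
    (r s : ℝ) :
    ∫ u in Icc r s, ∫ t in S, psdoIntegrand (compoundSymbol k a b) φ ξ t u =
      ∫ t in S, symbolKernel k a ξ t * 𝓕 ((Icc r s).indicator b) (ξ - t) * φ t := by
  rw [integral_integral_swap (integrable_prod_psdoIntegrand k ham ha hbm hb hφ hSm hS hφi hξ r s)]
  refine integral_congr_ae (ae_of_all _ fun t => ?_)
  simp only [psdoIntegrand_compoundSymbol]
  rw [integral_mul_const, fourier_eq_integral_exp, ← integral_indicator measurableSet_Icc]
  have h (u : ℝ) : (Icc r s).indicator (fun u : ℝ =>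
      Complex.exp (-2 * Real.pi * Complex.I * ((ξ - t : ℝ) : ℂ) * u) * b u) u =
      Complex.exp (-2 * Real.pi * Complex.I * ((ξ - t : ℝ) : ℂ) * u) *
        (Icc r s).indicator b u := by
    simp only [indicator]
    split_ifs <;> simp
  simp_rw [h]
  ring

/-- The truncated operators converge strongly. -/
theorem tendsto_symbolOp_indicator (k : ℕ) (ham : Measurable a) (ha : ∀ v, ‖a v‖ ≤ A)
    (hbm : Measurable b) (hb : ∀ u, ‖b u‖ ≤ B) (f : L2Pos) :
    Tendsto (fun p : ℝ × ℝ => symbolOp k _ (memLp_top_symbol ham ha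
      (hbm.indicator (measurableSet_Icc (a := p.1) (b := p.2)))
      (norm_indicator_symbol_le hb (Icc p.1 p.2))) f) (atBot ×ˢ atTop)
      (𝓝 (symbolOp k _ (memLp_top_symbol ham ha hbm hb) f)) := by
  have hA0 : 0 ≤ A := (norm_nonneg _).trans (ha 0)
  have hB0 : 0 ≤ B := (norm_nonneg _).trans (hb 0)
  -- By continuity of the adjoint it is enough that the truncated multiplications converge on `V f`.
  -- They do so by domination: each `u` eventually lies in `[r, s]`.
  refine ((ContinuousLinearMap.adjoint
    (waveletIsometry k).toContinuousLinearMap).continuous.tendsto _).comp ?_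
  set F : L2G := waveletIsometry k f
  have hnorm (c : ℂ) (hc : ‖c‖ ≤ B) (v : ℝ) (w : ℂ) :
      ‖a v * c * w‖ ≤ ‖((A * B : ℝ) : ℂ) * w‖ := by
    rw [norm_mul, norm_mul, norm_mul, Complex.norm_real, Real.norm_of_nonneg (by positivity)]
    gcongr
    exact ha v
  refine tendsto_Lp_two_of_dominated (fun p => coeFn_mulOp _ _ F) (coeFn_mulOp _ _ F)
    ((Lp.memLp F).const_mul ((A * B : ℝ) : ℂ)) (fun p => ae_of_all _ fun z => ?_)
    (ae_of_all _ fun z => ?_) (ae_of_all _ fun z => ?_)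
  · exact hnorm _ (norm_indicator_symbol_le hb _ _) _ _
  · exact hnorm _ (hb _) _ _
  · refine tendsto_const_nhds.congr' ?_
    have h1 : ∀ᶠ p : ℝ × ℝ in atBot ×ˢ atTop, p.1 ≤ z.1 ∧ z.1 ≤ p.2 :=
      (eventually_le_atBot z.1).prod_mk (eventually_ge_atTop z.1)
    filter_upwards [h1] with p hp
    rw [indicator_of_mem (show z.1 ∈ Icc p.1 p.2 from hp)]

theorem integrableOn_Ioc_of_L2Pos (f : L2Pos) (M : ℝ) : IntegrableOn f (Ioc 0 M) := by
  have : IsFiniteMeasure ((volume : Measure ℝ).restrict (Ioc 0 M)) :=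
    isFiniteMeasure_restrict.2 measure_Ioc_lt_top.ne
  exact ((Lp.memLp f).mono_measure
    (Measure.restrict_mono Ioc_subset_Ioi_self le_rfl)).integrable (by norm_num)

theorem tendsto_integral_psdoIntegrand (k : ℕ) (ham : Measurable a) (ha : ∀ v, ‖a v‖ ≤ A)
    (hbm : Measurable b) (hb : ∀ u, ‖b u‖ ≤ B) (f : L2Pos) (r s : ℝ) {ξ : ℝ} (hξ : 0 < ξ) :
    Tendsto (fun M : ℝ => ∫ u in Icc r s, ∫ t in Ioc 0 M,
      psdoIntegrand (compoundSymbol k a b) f ξ t u) atTop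
      (𝓝 (∫ t in Ioi (0 : ℝ), symbolKernel k a ξ t *
        𝓕 ((Icc r s).indicator b) (ξ - t) * f t)) := by
  have h1 := intervalIntegral_tendsto_integral_Ioi 0
    (integrableOn_symbolKernel_mul_fourier k ham ha (integrable_indicator_Icc hbm hb r s)
      (memLp_two_indicator_Icc hbm hb r s) f hξ) tendsto_id
  refine h1.congr' ?_
  filter_upwards [eventually_ge_atTop 0] with M hM
  rw [id, intervalIntegral.integral_of_le hM]
  exact (integral_psdoIntegrand_swap k ham ha hbm hb (Lp.stronglyMeasurable f).measurable
    measurableSet_Ioc Ioc_subset_Ioi_self (integrableOn_Ioc_of_L2Pos f M) hξ r s).symm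

/-- The inner integral is a bounded function of `u` times the inverse Fourier transform of `K(ξ, ·)
φ`. The latter product is smooth with compact support, so its transform is Schwartz and hence
integrable. -/
theorem integrable_integral_psdoIntegrand_of_contDiff (k : ℕ) (ham : Measurable a)
    (ha : ∀ v, ‖a v‖ ≤ A) (hbm : Measurable b) (hb : ∀ u, ‖b u‖ ≤ B) {φ : ℝ → ℂ}
    (hφ : ContDiff ℝ ∞ φ) (hc : HasCompactSupport φ) (hs : tsupport φ ⊆ Ioi 0) {ξ : ℝ}
    (hξ : 0 < ξ) :
    Integrable fun u => ∫ t in Ioi (0 : ℝ), psdoIntegrand (compoundSymbol k a b) φ ξ t u := by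
  set Φ : ℝ → ℂ := fun t => symbolKernel k a ξ t * φ t with hΦ
  have h1 : ContDiff ℝ ∞ Φ := by
    refine contDiff_iff_contDiffAt.2 fun t => ?_
    by_cases ht : t ∈ tsupport φ
    · exact ((contDiffOn_symbolKernel k ham ha hξ).contDiffAt (Ioi_mem_nhds (hs ht))).mul
        hφ.contDiffAt
    · have h2 : φ =ᶠ[𝓝 t] 0 := notMem_tsupport_iff_eventuallyEq.1 ht
      refine (contDiffAt_const (c := (0 : ℂ))).congr_of_eventuallyEq ?_
      filter_upwards [h2] with x hx
      simp [hΦ, hx]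
  have h2 : HasCompactSupport Φ := hc.mul_left
  have h3 : Integrable (𝓕⁻ Φ : ℝ → ℂ) := by
    have := (𝓕⁻ (h2.toSchwartzMap h1)).integrable (μ := volume)
    rw [SchwartzMap.fourierInv_coe] at this
    exact this
  refine (h3.bdd_mul (f := fun u : ℝ =>
    Complex.exp (-2 * Real.pi * Complex.I * (ξ : ℂ) * u) * b u) (c := B)
    ((Continuous.measurable (by fun_prop)).mul hbm).aestronglyMeasurable
    (ae_of_all _ fun u => ?_)).congr (ae_of_all _ fun u => ?_)
  · rw [norm_mul, norm_exp_neg_two_pi_I_mul, one_mul]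
    exact hb u
  · simp only
    rw [fourierInv_eq_integral_exp, ← integral_const_mul, ← integral_indicator measurableSet_Ioi]
    refine integral_congr_ae (ae_of_all _ fun t => ?_)
    simp only [indicator]
    split_ifs with ht
    · rw [psdoIntegrand_compoundSymbol, hΦ]
      have : Complex.exp (-2 * Real.pi * Complex.I * ((ξ - t : ℝ) : ℂ) * u) =
          Complex.exp (-2 * Real.pi * Complex.I * (ξ : ℂ) * u) *
            Complex.exp (2 * Real.pi * Complex.I * u * t) := by
        rw [← Complex.exp_add]
        congr 1
        push_cast; ring
      rw [this]
      ring
    · have : φ t = 0 := image_eq_zero_of_notMem_tsupport fun h => ht (hs h)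
      simp [hΦ, this]

theorem isPseudoDiffOp_symbolOp (k : ℕ) (ham : Measurable a) (ha : ∀ v, ‖a v‖ ≤ A)
    (hbm : Measurable b) (hb : ∀ u, ‖b u‖ ≤ B) :
    IsPseudoDiffOp (compoundSymbol k a b)
      (symbolOp k _ (memLp_top_symbol ham ha hbm hb)) where
  improper f := by
    -- The witness is the operator with `b` cut off to `[r, s]`, applied to `f`.
    refine ⟨_, fun r s => ?_, tendsto_symbolOp_indicator k ham ha hbm hb f⟩
    have hf := (Lp.stronglyMeasurable f).measurable
    filter_upwards [ae_restrict_mem measurableSet_Ioi,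
      symbolOp_ae_eq k ham ha (hbm.indicator (measurableSet_Icc (a := r) (b := s)))
      (integrable_indicator_Icc hbm hb r s) (memLp_two_indicator_Icc hbm hb r s)
      (memLp_top_symbol ham ha (hbm.indicator measurableSet_Icc)
        (norm_indicator_symbol_le hb (Icc r s))) f] with ξ hξ h1
    refine ⟨fun M => ⟨ae_of_all _ fun u => ?_, ?_⟩, ?_⟩
    · exact integrableOn_psdoIntegrand k ham ha hbm hb hf measurableSet_Ioc
        Ioc_subset_Ioi_self (integrableOn_Ioc_of_L2Pos f M) hξ u
    · exact (integrable_prod_psdoIntegrand k ham ha hbm hb hf measurableSet_Ioc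
        Ioc_subset_Ioi_self (integrableOn_Ioc_of_L2Pos f M) hξ r s).integral_prod_left
    · rw [h1]
      exact tendsto_integral_psdoIntegrand k ham ha hbm hb f r s hξ
  test φ hφ hc hs f hf := by
    have h1 : Tendsto (fun n : ℕ => (-(n : ℝ), (n : ℝ))) atTop (atBot ×ˢ atTop) :=
      (tendsto_neg_atTop_atBot.comp tendsto_natCast_atTop_atTop).prodMk
        tendsto_natCast_atTop_atTop
    obtain ⟨ns, hns, h2⟩ := (tendstoInMeasure_of_tendsto_Lp
      ((tendsto_symbolOp_indicator k ham ha hbm hb f).comp h1)).exists_seq_tendsto_ae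
    have h3 : ∀ᵐ ξ ∂(volume : Measure ℝ).restrict (Ioi 0), ∀ n : ℕ,
        symbolOp k _ (memLp_top_symbol ham ha
          (hbm.indicator (measurableSet_Icc (a := -(n : ℝ)) (b := n)))
          (norm_indicator_symbol_le hb (Icc (-(n : ℝ)) n))) f ξ =
        ∫ t in Ioi (0 : ℝ), symbolKernel k a ξ t *
          𝓕 ((Icc (-(n : ℝ)) n).indicator b) (ξ - t) * f t :=
      ae_all_iff.2 fun n => symbolOp_ae_eq k ham ha (hbm.indicator measurableSet_Icc)
        (integrable_indicator_Icc hbm hb _ _) (memLp_two_indicator_Icc hbm hb _ _) _ f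
    have hφm := hφ.continuous.measurable
    have hφi : IntegrableOn φ (Ioi 0) :=
      (hφ.continuous.integrable_of_hasCompactSupport hc).integrableOn
    filter_upwards [ae_restrict_mem measurableSet_Ioi, h2, h3] with ξ hξ h4 h5
    have hi := integrable_integral_psdoIntegrand_of_contDiff k ham ha hbm hb hφ hc hs hξ
    refine ⟨ae_of_all _ fun u => integrableOn_psdoIntegrand k ham ha hbm hb hφm
      measurableSet_Ioi Subset.rfl hφi hξ u, hi, ?_⟩
    -- Along `[-n, n]` the truncated values have two limits: `C f` on an almost everywhere
    -- convergent subsequence, and the full outer integral, which is now known to converge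
    -- absolutely.
    refine tendsto_nhds_unique h4 (Tendsto.comp (g := fun n : ℕ => symbolOp k _
      (memLp_top_symbol ham ha (hbm.indicator (measurableSet_Icc (a := -(n : ℝ)) (b := n)))
        (norm_indicator_symbol_le hb (Icc (-(n : ℝ)) n))) f ξ) ?_ hns.tendsto_atTop)
    have hU : ⋃ n : ℕ, Icc (-(n : ℝ)) n = univ := by
      refine eq_univ_of_forall fun x => mem_iUnion.2 ?_
      obtain ⟨n, hn⟩ := exists_nat_ge |x|
      exact ⟨n, abs_le.1 hn⟩
    have h6 := tendsto_setIntegral_of_monotone (μ := volume) (s := fun n : ℕ => Icc (-(n : ℝ)) n)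
      (fun _ => measurableSet_Icc) (fun m n hmn => Icc_subset_Icc (by simpa using hmn)
        (by simpa using hmn)) (by rw [hU]; exact hi.integrableOn)
    rw [hU, setIntegral_univ] at h6
    refine h6.congr fun n => ?_
    rw [h5 n, integral_psdoIntegrand_swap k ham ha hbm hb hφm measurableSet_Ioi Subset.rfl
      hφi hξ]
    refine integral_congr_ae ?_
    filter_upwards [hf] with t ht
    rw [ht]

end BoundedSymbol

/-! ### Reduction to bounded measurable factors. -/

theorem IsPseudoDiffOp.congr {σ σ' : ℝ → ℝ → ℝ → ℂ} {C : L2Pos →L[ℂ] L2Pos}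
    (hC : IsPseudoDiffOp σ' C) (h : ∀ᵐ u : ℝ, ∀ ξ t, σ ξ t u = σ' ξ t u) :
    IsPseudoDiffOp σ C := by
  have hp (f : ℝ → ℂ) : ∀ᵐ u : ℝ, ∀ ξ t, psdoIntegrand σ f ξ t u = psdoIntegrand σ' f ξ t u := by
    filter_upwards [h] with u hu ξ t
    rw [psdoIntegrand, psdoIntegrand, hu]
  have hI (f : ℝ → ℂ) (S : Set ℝ) (ξ : ℝ) : (fun u => ∫ t in S, psdoIntegrand σ f ξ t u) =ᵐ[volume]
      fun u => ∫ t in S, psdoIntegrand σ' f ξ t u := by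
    filter_upwards [hp f] with u hu
    simp only [hu]
  have hi (f : ℝ → ℂ) (S : Set ℝ) (ξ : ℝ)
      (h0 : ∀ᵐ u : ℝ, IntegrableOn (fun t => psdoIntegrand σ' f ξ t u) S) :
      ∀ᵐ u : ℝ, IntegrableOn (fun t => psdoIntegrand σ f ξ t u) S := by
    filter_upwards [h0, hp f] with u h1 hu
    simpa only [hu] using h1
  refine ⟨fun φ h1 h2 h3 f hf => ?_, fun f => ?_⟩
  · filter_upwards [hC.test φ h1 h2 h3 f hf] with ξ hξ
    refine ⟨hi _ _ _ hξ.1, hξ.2.1.congr (hI _ _ _).symm, ?_⟩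
    rw [hξ.2.2, integral_congr_ae (hI _ _ _)]
  · obtain ⟨g, hg, hlim⟩ := hC.improper f
    refine ⟨g, fun r s => ?_, hlim⟩
    filter_upwards [hg r s] with ξ hξ
    refine ⟨fun M => ⟨hi _ _ _ (hξ.1 M).1, (hξ.1 M).2.congr (ae_restrict_of_ae (hI _ _ _).symm)⟩,
      hξ.2.congr fun M => ?_⟩
    exact (integral_congr_ae (ae_restrict_of_ae (hI _ _ _))).symm

theorem exists_measurable_bounded_ae_eq {α : Type*} [MeasurableSpace α] {μ : Measure α}
    {f : α → ℂ} (hf : AEStronglyMeasurable f μ) {K : ℝ} (hK : ∀ᵐ x ∂μ, ‖f x‖ ≤ K) :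
    ∃ (g : α → ℂ) (B : ℝ), Measurable g ∧ (∀ x, ‖g x‖ ≤ B) ∧ f =ᵐ[μ] g := by
  have hm := hf.stronglyMeasurable_mk.measurable
  -- The absolute value keeps the bound valid at points where the cutoff is zero: `K` may be
  -- negative if the measure is zero.
  refine ⟨{x | ‖hf.mk f x‖ ≤ |K|}.indicator (hf.mk f), |K|,
    hm.indicator (measurableSet_le hm.norm measurable_const), fun x => ?_, ?_⟩
  · simp only [indicator, mem_ofPred_eq]
    split_ifs with h
    · exact h
    · simp
  · filter_upwards [hf.ae_eq_mk, hK] with x hx h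
    rw [indicator_of_mem, hx]
    simpa only [mem_ofPred_eq, ← hx] using h.trans (le_abs_self K)

theorem haarWeight_absolutelyContinuous :
    haarWeight ≪ (volume : Measure ℝ).restrict (Ioi 0) :=
  withDensity_absolutelyContinuous _ _

theorem absolutelyContinuous_haarWeight :
    (volume : Measure ℝ).restrict (Ioi 0) ≪ haarWeight := by
  refine withDensity_absolutelyContinuous' (by fun_prop) ?_
  filter_upwards [ae_restrict_mem measurableSet_Ioi] with v hv
  have hv' : 0 < v := hv
  simp only [ne_eq, ENNReal.ofReal_eq_zero, not_le]
  positivity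

theorem prod_absolutelyContinuous_haarG :
    (volume : Measure ℝ).prod ((volume : Measure ℝ).restrict (Ioi 0)) ≪ haarG :=
  Measure.AbsolutelyContinuous.prod Measure.AbsolutelyContinuous.rfl absolutelyContinuous_haarWeight

theorem ae_norm_le_of_memLp_top {α : Type*} [MeasurableSpace α] {μ : Measure α} {c : α → ℂ}
    (hc : MemLp c (⊤ : ℝ≥0∞) μ) : ∃ K : ℝ, ∀ᵐ z ∂μ, ‖c z‖ ≤ K := by
  have h := hc.2
  rw [eLpNorm_exponent_top] at h
  refine ⟨(eLpNormEssSup c μ).toReal, ?_⟩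
  filter_upwards [enorm_ae_le_eLpNormEssSup c μ] with z hz
  rw [← toReal_enorm]
  exact ENNReal.toReal_mono h.ne hz

section Symbol

variable {a b : ℝ → ℂ}

theorem ae_symbol_slice (hc : MemLp (fun z : ℝ × ℝ => a z.2 * b z.1) (⊤ : ℝ≥0∞) haarG) :
    ∃ K : ℝ, (∀ᵐ u : ℝ, AEStronglyMeasurable (fun v => a v * b u) (volume.restrict (Ioi 0)) ∧
        ∀ᵐ v ∂(volume : Measure ℝ).restrict (Ioi 0), ‖a v * b u‖ ≤ K) ∧
      ∀ᵐ v ∂(volume : Measure ℝ).restrict (Ioi 0), AEStronglyMeasurable (fun u => a v * b u) ∧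
        ∀ᵐ u : ℝ, ‖a v * b u‖ ≤ K := by
  obtain ⟨K, hK⟩ := ae_norm_le_of_memLp_top hc
  have hK' := prod_absolutelyContinuous_haarG.ae_le hK
  have hm := hc.1.mono_ac prod_absolutelyContinuous_haarG
  refine ⟨K, ?_, ?_⟩
  · filter_upwards [hm.prodMk_left, Measure.ae_ae_of_ae_prod hK'] with u h1 h2
    exact ⟨h1, h2⟩
  · have hs := (Measure.measurePreserving_swap (μ := (volume : Measure ℝ).restrict (Ioi 0))
      (ν := (volume : Measure ℝ)))
    have h3 := hm.comp_measurePreserving hs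
    have h4 := hs.quasiMeasurePreserving.ae hK'
    filter_upwards [h3.prodMk_left, Measure.ae_ae_of_ae_prod h4] with v h1 h2
    exact ⟨h1, h2⟩

/-- Dividing a good slice of the product by a nonzero value of one factor shows that the other is
measurable and essentially bounded. If one factor vanishes almost everywhere, nothing is known about
the other; then both are replaced by zero, which changes neither the product almost everywhere nor
the compound symbol for almost every `u`. -/
theorem exists_measurable_bounded_symbol (k : ℕ)
    (hc : MemLp (fun z : ℝ × ℝ => a z.2 * b z.1) (⊤ : ℝ≥0∞) haarG) :
    ∃ (a' b' : ℝ → ℂ) (A B : ℝ), Measurable a' ∧ (∀ v, ‖a' v‖ ≤ A) ∧ Measurable b' ∧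
      (∀ u, ‖b' u‖ ≤ B) ∧
      (fun z : ℝ × ℝ => a z.2 * b z.1) =ᵐ[haarG] (fun z => a' z.2 * b' z.1) ∧
      ∀ᵐ u : ℝ, ∀ ξ t, compoundSymbol k a b ξ t u = compoundSymbol k a' b' ξ t u := by
  have hfst {p : ℝ → Prop} (h : ∀ᵐ u : ℝ, p u) : ∀ᵐ z ∂haarG, p z.1 :=
    Measure.quasiMeasurePreserving_fst.ae h
  have hsnd {p : ℝ → Prop} (h : ∀ᵐ v ∂(volume : Measure ℝ).restrict (Ioi 0), p v) :
      ∀ᵐ z ∂haarG, p z.2 :=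
    Measure.quasiMeasurePreserving_snd.ae (haarWeight_absolutelyContinuous.ae_le h)
  by_cases hb : ∀ᵐ u : ℝ, b u = 0
  · refine ⟨0, 0, 0, 0, measurable_zero, by simp, measurable_zero, by simp, ?_, ?_⟩
    · filter_upwards [hfst hb] with z hz
      simp [hz]
    · filter_upwards [hb] with u hu ξ t
      simp [compoundSymbol, hu]
  by_cases ha : ∀ᵐ v ∂(volume : Measure ℝ).restrict (Ioi 0), a v = 0
  · refine ⟨0, 0, 0, 0, measurable_zero, by simp, measurable_zero, by simp, ?_, ?_⟩
    · filter_upwards [hsnd ha] with z hz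
      simp [hz]
    · refine ae_of_all _ fun u ξ t => ?_
      have h0 : ∫ v in Ioi (0 : ℝ), a v * (laguerreFun k (2 * v * ξ) : ℂ) *
          (laguerreFun k (2 * v * t) : ℂ) = 0 := by
        refine integral_eq_zero_of_ae ?_
        filter_upwards [ha] with v hv
        simp [hv]
      simp [compoundSymbol, h0]
  obtain ⟨K, h1, h2⟩ := ae_symbol_slice hc
  obtain ⟨u, hu, hu1, hu2⟩ := ((not_eventually.1 hb).and_eventually h1).exists
  obtain ⟨v, hv, hv1, hv2⟩ := ((not_eventually.1 ha).and_eventually h2).exists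
  have hu' : 0 < ‖b u‖ := norm_pos_iff.2 hu
  have hv' : 0 < ‖a v‖ := norm_pos_iff.2 hv
  have ham : AEStronglyMeasurable a (volume.restrict (Ioi 0)) := by
    simpa only [mul_inv_cancel_right₀ hu] using hu1.mul_const (b u)⁻¹
  have hbm : AEStronglyMeasurable b volume := by
    simpa only [inv_mul_cancel_left₀ hv] using hv1.const_mul (a v)⁻¹
  have haK : ∀ᵐ v ∂(volume : Measure ℝ).restrict (Ioi 0), ‖a v‖ ≤ K / ‖b u‖ := by
    filter_upwards [hu2] with v h
    rwa [le_div_iff₀ hu', ← norm_mul]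
  have hbK : ∀ᵐ u : ℝ, ‖b u‖ ≤ K / ‖a v‖ := by
    filter_upwards [hv2] with u h
    rwa [le_div_iff₀ hv', mul_comm, ← norm_mul]
  obtain ⟨a', A, ham', haA, haa⟩ := exists_measurable_bounded_ae_eq ham haK
  obtain ⟨b', B, hbm', hbB, hbb⟩ := exists_measurable_bounded_ae_eq hbm hbK
  refine ⟨a', b', A, B, ham', haA, hbm', hbB, ?_, ?_⟩
  · filter_upwards [hfst hbb, hsnd haa] with z h3 h4
    rw [h3, h4]
  · filter_upwards [hbb] with u h3 ξ t
    have h0 : ∫ v in Ioi (0 : ℝ), a v * (laguerreFun k (2 * v * ξ) : ℂ) *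
          (laguerreFun k (2 * v * t) : ℂ) = ∫ v in Ioi (0 : ℝ), a' v *
          (laguerreFun k (2 * v * ξ) : ℂ) * (laguerreFun k (2 * v * t) : ℂ) := by
      refine integral_congr_ae ?_
      filter_upwards [haa] with v h4
      rw [h4]
    rw [compoundSymbol, compoundSymbol, h3, h0]

end Symbol

end CalderonToeplitz

theorem mainTheorem10 (k : ℕ) (a b : ℝ → ℂ)
    (hc : MemLp (fun z : ℝ × ℝ => a z.2 * b z.1) ∞ CalderonToeplitz.haarG) :
    ∃ _ : (CalderonToeplitz.waveletSpace k).HasOrthogonalProjection,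
      (∀ᵐ u : ℝ, ∀ ξ > 0, ∀ t > 0, IntegrableOn
        (fun v : ℝ => b u * (a v * (CalderonToeplitz.laguerreFun k (2 * v * ξ) : ℂ) *
          (CalderonToeplitz.laguerreFun k (2 * v * t) : ℂ))) (Ioi 0)) ∧
      ∃ C : CalderonToeplitz.L2Pos →L[ℂ] CalderonToeplitz.L2Pos,
        CalderonToeplitz.IsPseudoDiffOp (CalderonToeplitz.compoundSymbol k a b) C ∧
        ∃ W : CalderonToeplitz.waveletSpace k ≃ₗᵢ[ℂ] CalderonToeplitz.L2Pos,
          ∀ F : CalderonToeplitz.waveletSpace k,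
            W (CalderonToeplitz.calderonToeplitz k (fun z : ℝ × ℝ => a z.2 * b z.1) hc F) =
              C (W F) := by
  obtain ⟨hP, W, hW⟩ := CalderonToeplitz.exists_unitary_compression
    (CalderonToeplitz.waveletIsometry k) (CalderonToeplitz.range_waveletIsometry k)
  obtain ⟨a', b', A, B, ham, ha, hbm, hb, hcc, hσ⟩ :=
    CalderonToeplitz.exists_measurable_bounded_symbol k hc
  refine ⟨hP, ?_, CalderonToeplitz.symbolOp k _ (CalderonToeplitz.memLp_top_symbol ham ha hbm hb),
    (CalderonToeplitz.isPseudoDiffOp_symbolOp k ham ha hbm hb).congr hσ, W, fun F => ?_⟩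
  · obtain ⟨K, h1, -⟩ := CalderonToeplitz.ae_symbol_slice hc
    filter_upwards [h1] with u hu ξ hξ t ht
    -- The slice `v ↦ a v * b u` plays the role of the bounded factor, so `a` itself need not be
    -- measurable.
    refine (CalderonToeplitz.integrableOn_symbol k hu.1 hu.2 hξ ht).congr
      (ae_of_all _ fun v => ?_)
    simp only
    ring
  · rw [CalderonToeplitz.calderonToeplitz, hW, CalderonToeplitz.mulOp_congr hc
      (CalderonToeplitz.memLp_top_symbol ham ha hbm hb) hcc]
    rfl
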